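/- Let $n\ge 0$, let $[-n;n]=\{-n,\dots,-1,1,\dots,n\}$, and let $J_{2n}$ be the $2n\times 2n$ matrix with ones on the anti-diagonal and zeros elsewhere, rows and columns indexed by $[-n;n]$. Let $\mathfrak o_{2n}$ be the Lie algebra of complex matrices $X$ with $X^TJ_{2n}+J_{2n}X=0$; it contains $F_{i,j}=E_{i,j}-E_{-j,-i}$. Let $\hat{\mathfrak o}_{2n}=\mathfrak o_{2n}[t,t^{-1}]\oplus\mathbb C K$ with $K$ central and, for $X[r]=Xt^r$, $$[X[r],Y[s]]=[X,Y][r+s]+r\,\delta_{r,-s}\,\tfrac12\operatorname{tr}(XY)\,K,$$ and adjoin $\tau$ with $[\tau,X[r]]=-rX[r-1]$, $[\tau,K]=0$. Let $\mathrm{ad}_\tau: f\mapsto[\tau,f]$ be the corresponding derivation of $U(\hat{\mathfrak o}_{2n})$. Put $F[r]=(F_{i,j}[r])_{i,j\in[-n;n]}$, $\tilde F[-1]=F[-1]J_{2n}$ and $$\operatorname{Pf}\tilde F[-1]=\frac1{2^nn!}\sum_{\sigma}\operatorname{sgn}(\sigma)\,\tilde F_{\sigma(-n),\sigma(-n+1)}[-1]\cdots\tilde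 F_{\sigma(n-1),\sigma(n)}[-1],$$ the sum over all permutations $\sigma$ of $[-n;n]$. For a subset $I=\{i_1<\dots<i_{2l}\}$ of $\{-n,\dots,-1\}$ and a partition $\alpha=(\alpha_1\ge\dots\ge\alpha_l\ge1)$ put $$\operatorname{Pf}\Phi_{-I,I}[-\alpha]=\frac1{2^ll!}\sum_{\sigma\in S_{2l}}\operatorname{sgn}(\sigma)\,F_{-i_{\sigma(1)},i_{\sigma(2)}}[-\alpha_1]\cdots F_{-i_{\sigma(2l-1)},i_{\sigma(2l)}}[-\alpha_l],$$ $$\operatorname{Pf}\Phi_{I,-I}[-\alpha]=\frac1{2^ll!}\sum_{\sigma\in S_{2l}}\operatorname{sgn}(\sigma)\,F_{i_{\sigma(1)},-i_{\sigma(2)}}[-\alpha_1]\cdots F_{i_{\sigma(2l-1)},-i_{\sigma(2l)}}[-\alpha_l].$$ For subsets $A=\{a_1<\dots<a_k\}$ and $B=\{b_1<\dots<b_k\}$ of $\{-n,\dots,-1\}$ let $$\det\Phi_{A,B}[-1]\cdot 1=\sum_{\sigma\in S_k}\operatorname{sgn}(\sigma)\,\Phi_{a_{\sigma(1)},b_1}\cdots\Phi_{a_{\sigma(k)},b_k}\cdot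 1,\qquad \Phi_{i,j}=F_{i,j}[-1]+\delta_{ij}\,\mathrm{ad}_\tau,$$ where $F_{i,j}[-1]$ acts on $U(\hat{\mathfrak o}_{2n})$ by left multiplication. Then $$\begin{aligned}\operatorname{Pf}\tilde F[-1]=\sum_{l=0}^{\lfloor n/2\rfloor}\ \sum_{\substack{a,b\ge0\\a+b\le n}}\ \sum_{J,I_1,J_1,I_2,J_2}&\operatorname{sgn}(J,J_2,I_2)\,\operatorname{sgn}(-I_1,-\tilde J_1,-\tilde J)\Bigl(\sum_{\alpha\vdash a,\ \ell(\alpha)=l}\frac{l!}{m_1!\,m_2!\cdots}\operatorname{Pf}\Phi_{-I_1,I_1}[-\alpha]\Bigr)\\ &\times (a+b-2l)!\,\bigl(\det\Phi_{J_2,J_1}[-1]\cdot1\bigr)\Bigl(\sum_{\beta\vdash b,\ \ell(\beta)=l}\frac{l!}{m_1'!\,m_2'!\cdots}\operatorname{Pf}\Phi_{I_2,-I_2}[-\beta]\Bigr).\end{aligned}$$ Here $\alpha=(1^{m_1},2^{m_2},\dots)$ and $\beta=(1^{m_1'},2^{m_2'},\dots)$ run over partitions with exactly $l$ parts (terms for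 which no such partition exists are $0$). The third sum is over subsets of $\{-n,\dots,-1\}$ with $$I_1\sqcup J_1\sqcup J=J\sqcup J_2\sqcup I_2=\{-n,\dots,-1\},\qquad |I_1|=|I_2|=2l,\qquad |J_1|=|J_2|=n-a-b.$$ The sign $\operatorname{sgn}(J,J_2,I_2)$ is that of the permutation putting in increasing order the string formed by $J$, $J_2$, $I_2$, in this order, each written increasingly. The sign $\operatorname{sgn}(-I_1,-\tilde J_1,-\tilde J)$ is defined likewise for the string formed by $-I_1$, $-\tilde J_1$, $-\tilde J$, where for $I=\{i_1<\dots<i_k\}$ the string $-I$ is $(-i_1,\dots,-i_k)$ (decreasing) and $-\tilde I$ is $(-i_k,\dots,-i_1)$ (increasing). -/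

import Mathlib

open Finset
open scoped TensorProduct

noncomputable section

attribute [local instance 100] LieRing.ofAssociativeRing

namespace AffinePfaffian

/-! ## The index set, and the orthogonal Lie algebra -/

/-- The index set `[-n; n] = {-n, …, -1, 1, …, n}` with its usual order. -/
abbrev Idx (n : ℕ) : Type := {i : ℤ // i ∈ (Finset.Icc (-(n : ℤ)) n).erase 0}

/-- The index `-i`. -/
def Idx.neg {n : ℕ} (i : Idx n) : Idx n :=
  ⟨-i.1, by have := i.2; simp only [mem_erase, mem_Icc] at this ⊢; omega⟩

/-- The `k`-th element (`k = 0, …, 2n - 1`) of `[-n; n]` in increasing order. -/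
def Idx.enum (n : ℕ) (k : Fin (2 * n)) : Idx n :=
  ⟨if (k : ℕ) < n then (k : ℤ) - n else (k : ℤ) - n + 1, by
    have := k.2; simp only [mem_erase, mem_Icc]; split_ifs <;> omega⟩

@[simp] lemma Idx.neg_neg {n : ℕ} (i : Idx n) : i.neg.neg = i :=
  Subtype.ext (_root_.neg_neg i.1)

lemma Idx.eq_neg_iff {n : ℕ} {i j : Idx n} : i = j.neg ↔ i.neg = j :=
  ⟨fun h => by rw [h, Idx.neg_neg], fun h => by rw [← h, Idx.neg_neg]⟩

/-- The matrix `J_{2n}` with ones on the anti-diagonal and zeros elsewhere. -/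
def antiDiag (n : ℕ) (R : Type*) [Zero R] [One R] : Matrix (Idx n) (Idx n) R :=
  Matrix.of fun i j => if i = j.neg then 1 else 0

/-- The Lie algebra `𝔬_{2n}` of complex matrices `X` with `Xᵀ J + J X = 0`. -/
abbrev so (n : ℕ) : LieSubalgebra ℂ (Matrix (Idx n) (Idx n) ℂ) :=
  skewAdjointMatricesLieSubalgebra (antiDiag n ℂ)

lemma mem_so {n : ℕ} {X : Matrix (Idx n) (Idx n) ℂ} :
    X ∈ so n ↔ X.transpose * antiDiag n ℂ + antiDiag n ℂ * X = 0 := by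
  rw [mem_skewAdjointMatricesLieSubalgebra, mem_skewAdjointMatricesSubmodule,
    Matrix.IsSkewAdjoint, Matrix.IsAdjointPair, Matrix.mul_neg, eq_neg_iff_add_eq_zero]

/-- The matrix `F_{i,j} = E_{i,j} - E_{-j,-i}`. -/
def matF {n : ℕ} (i j : Idx n) : Matrix (Idx n) (Idx n) ℂ :=
  Matrix.single i j 1 - Matrix.single j.neg i.neg 1

lemma matF_mem {n : ℕ} (i j : Idx n) : matF i j ∈ so n := by
  rw [mem_so]
  ext a b
  have h1 (X : Matrix (Idx n) (Idx n) ℂ) : (X.transpose * antiDiag n ℂ) a b = X b.neg a := by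
    simp [Matrix.mul_apply, antiDiag]
  have h2 (X : Matrix (Idx n) (Idx n) ℂ) : (antiDiag n ℂ * X) a b = X a.neg b := by
    simp [Matrix.mul_apply, antiDiag, Idx.eq_neg_iff (i := a)]
  have h3 (c d : Idx n) : (j.neg = c.neg ∧ i.neg = d) ↔ (i = d.neg ∧ j = c) := by
    rw [← Idx.eq_neg_iff, ← Idx.eq_neg_iff, Idx.neg_neg, and_comm]
  rw [Matrix.add_apply, h1, h2, matF, Matrix.sub_apply, Matrix.sub_apply]
  simp only [Matrix.single_apply, h3, Matrix.zero_apply]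
  ring

/-- The element `F_{i,j}` of `𝔬_{2n}`. -/
def genF {n : ℕ} (i j : Idx n) : so n := ⟨matF i j, matF_mem i j⟩

/-- The bilinear form `⟨X, Y⟩ = ½ tr (X Y)` on `𝔬_{2n}`. -/
def halfTrace (n : ℕ) : LinearMap.BilinForm ℂ (so n) :=
  LinearMap.mk₂ ℂ (fun X Y => (1 / 2 : ℂ) * Matrix.trace (X.1 * Y.1))
    (fun X X' Y => by simp [add_mul, mul_add]) (fun c X Y => by simp; ring)
    (fun X Y Y' => by simp [mul_add]) (fun c X Y => by simp; ring)

@[simp] lemma halfTrace_apply {n : ℕ} (X Y : so n) :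
    halfTrace n X Y = (1 / 2 : ℂ) * Matrix.trace (X.1 * Y.1) := rfl

lemma halfTrace_symm (n : ℕ) : (-halfTrace n).IsSymm :=
  ⟨fun X Y => by simp [Matrix.trace_mul_comm X.1 Y.1]⟩

lemma halfTrace_invariant (n : ℕ) : (-halfTrace n).lieInvariant (so n) := by
  intro X Y Z
  have h : Matrix.trace (X.1 * (Y.1 * Z.1)) = Matrix.trace (Y.1 * (Z.1 * X.1)) := by
    rw [Matrix.trace_mul_comm, mul_assoc]
  simp [LieRing.of_associative_ring_bracket, sub_mul, mul_sub, h, mul_assoc]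

/-! ## The affine Kac–Moody algebra -/

/-- The loop algebra `𝔬_{2n}[t, t⁻¹]`. -/
abbrev Loop (n : ℕ) : Type := LieAlgebra.loopAlgebra ℂ ℤ (so n)

/-- The cocycle `(X tʳ, Y tˢ) ↦ r δ_{r,-s} ⟨X, Y⟩`. Mathlib's cocycle attached to a form `Φ` is
`(X tʳ, Y tˢ) ↦ s δ_{r,-s} Φ (X, Y)`, hence `Φ = -⟨·, ·⟩` here; see `affine_bracket`. -/
def affineCocycle (n : ℕ) :
    LieModule.Cohomology.twoCocycle ℂ (Loop n) (TrivialLieModule ℂ (Loop n) ℂ) :=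
  LieAlgebra.LoopAlgebra.twoCocycleOfBilinear ℂ ℤ (so n) (-halfTrace n)
    (halfTrace_invariant n) (halfTrace_symm n)

/-- The affine Kac–Moody algebra `𝔬_{2n}[t, t⁻¹] ⊕ ℂ K`. -/
abbrev Affine (n : ℕ) : Type := LieAlgebra.ofTwoCocycle (affineCocycle n)

/-- The element `X[r] = X tʳ`. -/
def mode {n : ℕ} (X : so n) (r : ℤ) : Affine n :=
  LieAlgebra.ofTwoCocycle.mk (AddMonoidAlgebra.single r (1 : ℂ) ⊗ₜ[ℂ] X, 0)

/-- The central element `K`. -/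
def central (n : ℕ) : Affine n := 
  LieAlgebra.ofTwoCocycle.mk (0, (TrivialLieModule.equiv ℂ (Loop n) ℂ).symm 1)

lemma residue_single {n : ℕ} (X Y : so n) (r s : ℤ) :
    LieAlgebra.LoopAlgebra.residuePairing ℂ ℤ (so n) (-halfTrace n)
      (AddMonoidAlgebra.single r (1 : ℂ) ⊗ₜ[ℂ] X) (AddMonoidAlgebra.single s (1 : ℂ) ⊗ₜ[ℂ] Y) =
      (if r = -s then (r : ℂ) else 0) * halfTrace n X Y := by
  rw [LieAlgebra.LoopAlgebra.residuePairing_apply_apply,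
    LieAlgebra.LoopAlgebra.toFinsupp_single_tmul, LieAlgebra.LoopAlgebra.toFinsupp_single_tmul,
    Finsupp.sum_single_index (by simp), Finsupp.single_apply]
  split_ifs with h
  · simp [h]
  · simp

/-- `[X[r], Y[s]] = [X, Y][r + s] + r δ_{r,-s} ⟨X, Y⟩ K`. -/
lemma affine_bracket {n : ℕ} (X Y : so n) (r s : ℤ) :
    ⁅mode X r, mode Y s⁆ =
      mode ⁅X, Y⁆ (r + s) + ((if r = -s then (r : ℂ) else 0) * halfTrace n X Y) • central n := by
  rw [LieAlgebra.bracket_ofTwoCocycle]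
  refine congrArg LieAlgebra.ofTwoCocycle.mk (Prod.ext ?_ ?_)
  · change ⁅AddMonoidAlgebra.single r (1 : ℂ) ⊗ₜ[ℂ] X, AddMonoidAlgebra.single s (1 : ℂ) ⊗ₜ[ℂ] Y⁆ =
      AddMonoidAlgebra.single (r + s) (1 : ℂ) ⊗ₜ[ℂ] ⁅X, Y⁆ + _ • (0 : Loop n)
    rw [smul_zero, add_zero, LieAlgebra.ExtendScalars.bracket_tmul,
      AddMonoidAlgebra.single_mul_single, mul_one]
  · have h := residue_single X Y r s
    have h' : ∀ c d : ℂ, c = d → c + 0 - 0 = 0 + d • (1 : ℂ) := fun c d e => by simp [e]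
    exact h' _ _ h

/-- `K` is central. -/
lemma lie_central {n : ℕ} (x : Affine n) : ⁅x, central n⁆ = 0 := by
  rw [LieAlgebra.bracket_ofTwoCocycle]
  refine congrArg LieAlgebra.ofTwoCocycle.mk (Prod.ext ?_ ?_)
  · simp [central, LieAlgebra.ofProd]
  · simp [central, LieAlgebra.ofProd, trivial_lie_zero]

/-- The operator `-d/dt` on `𝔬_{2n}[t, t⁻¹]`, that is `X tʳ ↦ -r X tʳ⁻¹`. -/
def loopDer (n : ℕ) : Loop n →ₗ[ℂ] Loop n :=
  LinearMap.rTensor (so n) ((AddMonoidAlgebra.basis ℤ ℂ).constr ℂ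
    fun r : ℤ => AddMonoidAlgebra.single (r - 1) (-(r : ℂ)))

lemma loopDer_single {n : ℕ} (r : ℤ) (X : so n) :
    loopDer n (AddMonoidAlgebra.single r (1 : ℂ) ⊗ₜ[ℂ] X) =
      -(r : ℂ) • (AddMonoidAlgebra.single (r - 1) (1 : ℂ) ⊗ₜ[ℂ] X) := by
  rw [loopDer, LinearMap.rTensor_tmul, ← AddMonoidAlgebra.basis_apply, Module.Basis.constr_basis,
    TensorProduct.smul_tmul', AddMonoidAlgebra.smul_single, smul_eq_mul, mul_one]

/-- `𝔬_{2n}[t, t⁻¹]` is spanned by the elements `X tʳ`. -/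
lemma loop_induction {n : ℕ} {P : Loop n → Prop} (x : Loop n)
    (single : ∀ (r : ℤ) (X : so n), P (AddMonoidAlgebra.single r (1 : ℂ) ⊗ₜ[ℂ] X))
    (add : ∀ x y, P x → P y → P (x + y)) : P x := by
  rw [← (LieAlgebra.LoopAlgebra.toFinsupp ℂ ℤ (so n)).symm_apply_apply x]
  induction LieAlgebra.LoopAlgebra.toFinsupp ℂ ℤ (so n) x using Finsupp.induction_linear with
  | zero => simpa using single 0 0
  | add f g hf hg => rw [map_add]; exact add _ _ hf hg
  | single r X => rw [LieAlgebra.LoopAlgebra.toFinsupp_symm_single]; exact single r X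

lemma loopDer_lie {n : ℕ} (x y : Loop n) :
    loopDer n ⁅x, y⁆ = ⁅x, loopDer n y⁆ - ⁅y, loopDer n x⁆ := by
  have hl (x x' y : Loop n) : ⁅x + x', y⁆ = ⁅x, y⁆ + ⁅x', y⁆ := add_lie x x' y
  have hr (x y y' : Loop n) : ⁅x, y + y'⁆ = ⁅x, y⁆ + ⁅x, y'⁆ := lie_add x y y'
  have hs (c : ℂ) (x y : Loop n) : ⁅x, c • y⁆ = c • ⁅x, y⁆ := lie_smul c x y
  induction x using loop_induction with
  | add x x' h h' => rw [hl, map_add, h, h', map_add, hl, hr]; abel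
  | single r X =>
    induction y using loop_induction with
    | add y y' h h' => rw [hr, map_add, h, h', map_add, hl, hr]; abel
    | single s Y =>
      rw [LieAlgebra.ExtendScalars.bracket_tmul, AddMonoidAlgebra.single_mul_single, mul_one,
        loopDer_single, loopDer_single, loopDer_single, hs, hs,
        LieAlgebra.ExtendScalars.bracket_tmul, AddMonoidAlgebra.single_mul_single, mul_one,
        LieAlgebra.ExtendScalars.bracket_tmul, AddMonoidAlgebra.single_mul_single, mul_one,
        ← lie_skew X Y, show r + s - 1 = r + (s - 1) by ring,
        show s + (r - 1) = r + (s - 1) by ring, TensorProduct.tmul_neg]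
      push_cast
      module

lemma residue_loopDer {n : ℕ} (x y : Loop n) :
    LieAlgebra.LoopAlgebra.residuePairing ℂ ℤ (so n) (-halfTrace n) x (loopDer n y) =
      LieAlgebra.LoopAlgebra.residuePairing ℂ ℤ (so n) (-halfTrace n) y (loopDer n x) := by
  induction x using loop_induction with
  | add x x' h h' => simp only [map_add, LinearMap.add_apply, h, h']
  | single r X =>
    induction y using loop_induction with
    | add y y' h h' => simp only [map_add, LinearMap.add_apply, h, h']
    | single s Y =>
      rw [loopDer_single, loopDer_single, map_smul, map_smul, residue_single, residue_single,
        halfTrace_apply, halfTrace_apply, Matrix.trace_mul_comm Y.1 X.1, smul_eq_mul, smul_eq_mul]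
      by_cases h : r = -(s - 1)
      · rw [if_pos h, if_pos (by omega)]; ring
      · rw [if_neg h, if_neg (by omega)]; ring

/-- The derivation `x ↦ [τ, x]` of the affine algebra: `[τ, X[r]] = -r X[r - 1]`, `[τ, K] = 0`. -/
def tauDer (n : ℕ) : LieDerivation ℂ (Affine n) (Affine n) where
  toFun x := LieAlgebra.ofTwoCocycle.mk (loopDer n x.carrier.1, 0)
  map_add' x y := by
    refine congrArg LieAlgebra.ofTwoCocycle.mk (Prod.ext (map_add (loopDer n) _ _) ?_)
    exact (add_zero _).symm
  map_smul' c x := by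
    refine congrArg LieAlgebra.ofTwoCocycle.mk (Prod.ext (map_smul (loopDer n) _ _) ?_)
    exact (smul_zero _).symm
  leibniz' x y := by
    rw [LieAlgebra.bracket_ofTwoCocycle, LieAlgebra.bracket_ofTwoCocycle,
      LieAlgebra.bracket_ofTwoCocycle]
    refine congrArg LieAlgebra.ofTwoCocycle.mk (Prod.ext ?_ ?_)
    · exact loopDer_lie x.carrier.1 y.carrier.1
    · have h := residue_loopDer x.carrier.1 y.carrier.1
      change (0 : ℂ) = LieAlgebra.LoopAlgebra.residuePairing ℂ ℤ (so n) (-halfTrace n)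
          x.carrier.1 (loopDer n y.carrier.1) + 0 - 0 -
        (LieAlgebra.LoopAlgebra.residuePairing ℂ ℤ (so n) (-halfTrace n)
          y.carrier.1 (loopDer n x.carrier.1) + 0 - 0)
      rw [h]; ring

lemma tauDer_mode {n : ℕ} (X : so n) (r : ℤ) :
    tauDer n (mode X r) = -(r : ℂ) • mode X (r - 1) := by
  refine congrArg LieAlgebra.ofTwoCocycle.mk (Prod.ext (loopDer_single r X) ?_)
  exact (smul_zero _).symm

lemma tauDer_central (n : ℕ) : tauDer n (central n) = 0 :=
  congrArg LieAlgebra.ofTwoCocycle.mk (Prod.ext (map_zero (loopDer n)) rfl)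

/-! ## The universal enveloping algebra and the operator `ad τ` -/

section EnvDer

variable {L : Type*} [LieRing L] [LieAlgebra ℂ L] (D : LieDerivation ℂ L L)

/-- The Lie algebra map `x ↦ x + ε D x` into `U(L)[ε]/(ε²)`. -/
def envDerAux : L →ₗ⁅ℂ⁆
    TrivSqZeroExt (UniversalEnvelopingAlgebra ℂ L) (UniversalEnvelopingAlgebra ℂ L) where
  toFun x := TrivSqZeroExt.inl (UniversalEnvelopingAlgebra.ι ℂ x) +
    TrivSqZeroExt.inr (UniversalEnvelopingAlgebra.ι ℂ (D x))
  map_add' x y := by ext <;> simp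
  map_smul' c x := by ext <;> simp
  map_lie' {x y} := by
    ext
    · simp [LieRing.of_associative_ring_bracket]
    · simp only [LieDerivation.apply_lie_eq_add, map_add, LieHom.map_lie,
        LieRing.of_associative_ring_bracket, TrivSqZeroExt.snd_add, TrivSqZeroExt.snd_sub,
        TrivSqZeroExt.snd_inl, TrivSqZeroExt.snd_inr, TrivSqZeroExt.snd_mul,
        TrivSqZeroExt.fst_add, TrivSqZeroExt.fst_inl, TrivSqZeroExt.fst_inr, zero_add, add_zero,
        smul_eq_mul, MulOpposite.smul_eq_mul_unop, MulOpposite.unop_op]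
      abel

/-- The extension of a derivation `D` of a Lie algebra `L` to a derivation of `U(L)`. -/
def envDer : UniversalEnvelopingAlgebra ℂ L →ₗ[ℂ] UniversalEnvelopingAlgebra ℂ L :=
  (TrivSqZeroExt.sndHom _ _).restrictScalars ℂ ∘ₗ
    (UniversalEnvelopingAlgebra.lift ℂ (envDerAux D)).toLinearMap

lemma envDer_ι (x : L) : envDer D (UniversalEnvelopingAlgebra.ι ℂ x) =
    UniversalEnvelopingAlgebra.ι ℂ (D x) := by
  change (UniversalEnvelopingAlgebra.lift ℂ (envDerAux D) _).snd = _
  rw [UniversalEnvelopingAlgebra.lift_ι_apply]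
  simp [envDerAux]

lemma fst_lift_envDerAux (f : UniversalEnvelopingAlgebra ℂ L) :
    (UniversalEnvelopingAlgebra.lift ℂ (envDerAux D) f).fst = f := by
  have h : (TrivSqZeroExt.fstHom ℂ _ _).comp (UniversalEnvelopingAlgebra.lift ℂ (envDerAux D)) =
      AlgHom.id ℂ (UniversalEnvelopingAlgebra ℂ L) := by
    refine UniversalEnvelopingAlgebra.hom_ext ℂ (LieHom.ext fun x => ?_)
    change (UniversalEnvelopingAlgebra.lift ℂ (envDerAux D)
      (UniversalEnvelopingAlgebra.ι ℂ x)).fst = UniversalEnvelopingAlgebra.ι ℂ x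
    rw [UniversalEnvelopingAlgebra.lift_ι_apply]
    simp [envDerAux]
  exact DFunLike.congr_fun h f

lemma envDer_mul (f g : UniversalEnvelopingAlgebra ℂ L) :
    envDer D (f * g) = envDer D f * g + f * envDer D g := by
  change (UniversalEnvelopingAlgebra.lift ℂ (envDerAux D) _).snd = _
  rw [map_mul, TrivSqZeroExt.snd_mul, fst_lift_envDerAux, fst_lift_envDerAux, add_comm]
  rfl

lemma map_envDer {A : Type*} [Ring A] [Algebra ℂ A] (φ : UniversalEnvelopingAlgebra ℂ L →ₐ[ℂ] A)
    (t : A) (h : ∀ x, φ (UniversalEnvelopingAlgebra.ι ℂ (D x)) =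
      ⁅t, φ (UniversalEnvelopingAlgebra.ι ℂ x)⁆) (f : UniversalEnvelopingAlgebra ℂ L) :
    φ (envDer D f) = ⁅t, φ f⁆ := by
  obtain ⟨f, rfl⟩ : ∃ g, UniversalEnvelopingAlgebra.mkAlgHom ℂ L g = f := Quotient.exists_rep f
  induction f using TensorAlgebra.induction with
  | algebraMap c =>
    have h1 : envDer D 1 = 0 := by
      have h1 := envDer_mul D 1 1
      rw [mul_one, mul_one, one_mul] at h1
      exact left_eq_add.mp h1
    rw [AlgHom.commutes, Algebra.algebraMap_eq_smul_one, map_smul, h1, smul_zero, map_zero,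
      map_smul, map_one, LieRing.of_associative_ring_bracket, mul_smul_comm, smul_mul_assoc,
      mul_one, one_mul, sub_self]
  | ι x =>
    have h1 := h x
    rw [← envDer_ι] at h1
    exact h1
  | mul f g hf hg =>
    rw [map_mul, envDer_mul, map_add, map_mul, map_mul, map_mul, hf, hg]
    simp only [LieRing.of_associative_ring_bracket, sub_mul, mul_sub, mul_assoc]
    abel
  | add f g hf hg => rw [map_add, map_add, map_add, map_add, hf, hg, lie_add]

end EnvDer

/-- The universal enveloping algebra of the affine Kac–Moody algebra. -/
abbrev UAffine (n : ℕ) : Type := UniversalEnvelopingAlgebra ℂ (Affine n)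

/-- The operator `ad τ : f ↦ [τ, f]` on the universal enveloping algebra: the derivation that
extends `x ↦ [τ, x]`. It is the commutator with `τ` by `adTau_eq_commutator`. -/
def adTau (n : ℕ) : Module.End ℂ (UAffine n) := envDer (tauDer n)

/-- The action of the one-dimensional Lie algebra `ℂ τ` on the affine algebra. -/
def tauAction (n : ℕ) : ℂ →ₗ⁅ℂ⁆ LieDerivation ℂ (Affine n) (Affine n) where
  toFun c := c • tauDer n
  map_add' _ _ := add_smul _ _ _
  map_smul' _ _ := mul_smul _ _ _
  map_lie' {c d} := by simp [LieRing.of_associative_ring_bracket, mul_comm]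

/-- The extended affine Kac–Moody algebra, the affine algebra plus `ℂ τ`. -/
abbrev ExtAffine (n : ℕ) : Type := LieAlgebra.SemiDirectSum (Affine n) ℂ (tauAction n)

/-- The element `τ`. -/
def tau (n : ℕ) : ExtAffine n := ⟨0, 1⟩

/-- The map of enveloping algebras induced by the inclusion of the affine algebra into the
extended one. -/
def toExt (n : ℕ) : UAffine n →ₐ[ℂ] UniversalEnvelopingAlgebra ℂ (ExtAffine n) :=
  UniversalEnvelopingAlgebra.lift ℂ
    ((UniversalEnvelopingAlgebra.ι ℂ).comp (LieAlgebra.SemiDirectSum.inl (tauAction n)))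

/-- In the enveloping algebra of the extended algebra, `ad τ` is the commutator with `τ`. -/
lemma adTau_eq_commutator {n : ℕ} (f : UAffine n) :
    toExt n (adTau n f) = ⁅UniversalEnvelopingAlgebra.ι ℂ (tau n), toExt n f⁆ := by
  refine map_envDer (tauDer n) (toExt n) _ (fun x => ?_) f
  rw [toExt, UniversalEnvelopingAlgebra.lift_ι_apply, UniversalEnvelopingAlgebra.lift_ι_apply,
    LieHom.comp_apply, LieHom.comp_apply, ← LieHom.map_lie]
  congr 1
  change (⟨tauDer n x, 0⟩ : ExtAffine n) =
    ⟨⁅(0 : Affine n), x⁆ + (1 : ℂ) • tauDer n x - (0 : ℂ) • tauDer n 0, ⁅(1 : ℂ), (0 : ℂ)⁆⟩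
  rw [zero_lie, zero_add, one_smul, zero_smul, sub_zero, lie_zero]

/-! ## Pfaffians and determinants -/

variable {n : ℕ}

/-- The element `F_{i,j}[r]` of the enveloping algebra. -/
def genU (i j : Idx n) (r : ℤ) : UAffine n := UniversalEnvelopingAlgebra.ι ℂ (mode (genF i j) r)

/-- The matrix `F[r]`. -/
def matU (n : ℕ) (r : ℤ) : Matrix (Idx n) (Idx n) (UAffine n) := Matrix.of fun i j => genU i j r

/-- The matrix `F̃[r] = F[r] J_{2n}`. -/
def matFtilde (n : ℕ) (r : ℤ) : Matrix (Idx n) (Idx n) (UAffine n) :=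
  matU n r * antiDiag n (UAffine n)

/-- The position `2 k` in a string of length `2 l`. -/
def evenPos {l : ℕ} (k : Fin l) : Fin (2 * l) := ⟨2 * k, by omega⟩

/-- The position `2 k + 1` in a string of length `2 l`. -/
def oddPos {l : ℕ} (k : Fin l) : Fin (2 * l) := ⟨2 * k + 1, by omega⟩

/-- `Pf F̃[-1] = 1 / (2ⁿ n!) ∑_σ sgn σ F̃_{σ(-n),σ(-n+1)}[-1] ⋯ F̃_{σ(n-1),σ(n)}[-1]`, the sum over
all permutations `σ` of `[-n; n]`, the product in this order. -/
def pfFtilde (n : ℕ) : UAffine n :=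
  (1 / (2 ^ n * (n.factorial : ℂ))) • ∑ σ : Equiv.Perm (Idx n), (Equiv.Perm.sign σ : ℤ) •
    (List.ofFn fun k : Fin n =>
      matFtilde n (-1) (σ (Idx.enum n (evenPos k))) (σ (Idx.enum n (oddPos k)))).prod

/-- The matrix `Φ[r] = F[r] + ad τ · Id`, with entries operators on the enveloping algebra on
which its elements act by left multiplication. -/
def matPhi (n : ℕ) (r : ℤ) : Matrix (Idx n) (Idx n) (Module.End ℂ (UAffine n)) :=
  Matrix.of fun i j => LinearMap.mulLeft ℂ (genU i j r) + if i = j then adTau n else 0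

/-- The column determinant `∑_σ sgn σ Φ_{i_σ(1),j_1}[-1] ⋯ Φ_{i_σ(k),j_k}[-1]`, an operator. -/
def detPhi {k : ℕ} (i j : Fin k → Idx n) : Module.End ℂ (UAffine n) :=
  ∑ σ : Equiv.Perm (Fin k), (Equiv.Perm.sign σ : ℤ) •
    (List.ofFn fun q : Fin k => matPhi n (-1) (i (σ q)) (j q)).prod

/-- `Pf Φ_{I,-I}[-β]`: the sum over `σ ∈ S_{2l}` of
`sgn σ F_{i_σ(1),-i_σ(2)}[-β_1] ⋯ F_{i_σ(2l-1),-i_σ(2l)}[-β_l]`, divided by `2ˡ l!`. -/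
def pfPlusMinus {l : ℕ} (i : Fin (2 * l) → Idx n) (β : Fin l → ℕ) : UAffine n :=
  (1 / (2 ^ l * (l.factorial : ℂ))) • ∑ σ : Equiv.Perm (Fin (2 * l)), (Equiv.Perm.sign σ : ℤ) •
    (List.ofFn fun k : Fin l =>
      genU (i (σ (evenPos k))) (i (σ (oddPos k))).neg (-(β k : ℤ))).prod

/-- `Pf Φ_{-I,I}[-α]`: the sum over `σ ∈ S_{2l}` of
`sgn σ F_{-i_σ(1),i_σ(2)}[-α_1] ⋯ F_{-i_σ(2l-1),i_σ(2l)}[-α_l]`, divided by `2ˡ l!`. -/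
def pfMinusPlus {l : ℕ} (i : Fin (2 * l) → Idx n) (α : Fin l → ℕ) : UAffine n :=
  (1 / (2 ^ l * (l.factorial : ℂ))) • ∑ σ : Equiv.Perm (Fin (2 * l)), (Equiv.Perm.sign σ : ℤ) •
    (List.ofFn fun k : Fin l =>
      genU (i (σ (evenPos k))).neg (i (σ (oddPos k))) (-(α k : ℤ))).prod

/-! ## Partitions -/

/-- The partitions of `a` with exactly `l` (positive) parts. -/
abbrev PartitionOfLength (a l : ℕ) : Type := {α : a.Partition // Multiset.card α.parts = l}

/-- The parts `α_1 ≥ α_2 ≥ ⋯ ≥ α_l`. -/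
def PartitionOfLength.part {a l : ℕ} (α : PartitionOfLength a l) (k : Fin l) : ℕ :=
  (α.1.parts.sort (· ≥ ·)).get (k.cast (by rw [Multiset.length_sort, α.2]))

/-- The coefficient `l! / (m_1! m_2! ⋯)` of `α = (1^{m_1}, 2^{m_2}, …)`. -/
def PartitionOfLength.coeff {a l : ℕ} (α : PartitionOfLength a l) : ℂ :=
  (l.factorial : ℂ) / ∏ s ∈ α.1.parts.toFinset, ((α.1.parts.count s).factorial : ℂ)

/-! ## Subsets, strings and signs -/

/-- The subset `{-n, …, -1}` of `[-n; n]`. -/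
def negatives (n : ℕ) : Finset (Idx n) := univ.filter fun i => i.1 < 0

/-- Subsets `J, I₁, J₁, I₂, J₂` with `I₁ ⊔ J₁ ⊔ J = J ⊔ J₂ ⊔ I₂ = {-n, …, -1}`,
`|I₁| = |I₂| = 2 l` and `|J₁| = |J₂| = k`. -/
structure SubsetData (n l k : ℕ) where
  (J I₁ J₁ I₂ J₂ : Finset (Idx n))
  union₁ : I₁ ∪ J₁ ∪ J = negatives n
  disjoint_I₁_J₁ : Disjoint I₁ J₁
  disjoint_I₁_J : Disjoint I₁ J
  disjoint_J₁_J : Disjoint J₁ J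
  union₂ : J ∪ J₂ ∪ I₂ = negatives n
  disjoint_J_J₂ : Disjoint J J₂
  disjoint_J_I₂ : Disjoint J I₂
  disjoint_J₂_I₂ : Disjoint J₂ I₂
  card_I₁ : #I₁ = 2 * l
  card_I₂ : #I₂ = 2 * l
  card_J₁ : #J₁ = k
  card_J₂ : #J₂ = k

instance (n l k : ℕ) : Fintype (SubsetData n l k) :=
  Fintype.ofInjective (fun S => (S.J, S.I₁, S.J₁, S.I₂, S.J₂)) fun S T h => by
    cases S; cases T; simp_all

/-- The elements of `I` written in increasing order. -/
def increasing (I : Finset (Idx n)) : List (Idx n) := I.sort (· ≤ ·)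

/-- For `I = (i_1 < ⋯ < i_k)` the string `-I = (-i_1, …, -i_k)`, which is decreasing. -/
def negString (I : Finset (Idx n)) : List (Idx n) := (increasing I).map Idx.neg

/-- For `I = (i_1 < ⋯ < i_k)` the string `-Ĩ = (-i_k, …, -i_1)`, which is increasing. -/
def negStringRev (I : Finset (Idx n)) : List (Idx n) := (negString I).reverse

/-- The sign of the permutation of the positions of a string that puts its elements in increasing
order. -/
def stringSign (s : List (Idx n)) : ℤ := Equiv.Perm.sign (Tuple.sort s.get)

end AffinePfaffian

end

open AffinePfaffian

/-!
The expansion is a Gauss decomposition in a Howe dual `SL₂`, read off at the top word of an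
exterior algebra.

Let `Ext n` be the exterior algebra on anticommuting generators `e i` with `i ∈ [-n; n]`, and put
`X = ½ ∑ e a e b ⊗ F_{a,-b}[-1]` in `Ext n ⊗ U`. The `n`-th power of `X` is `n! Pf F̃[-1]` times the
top word, by `tensorFunctional_total_pow_eq_pf`. Sorting the indices by their signs gives
`X = P + D + M`: both indices positive in `P`, both negative in `M`, one of each in `D`.

Put `ω = ∑ e i e (-i)`, the sum over `i < 0`; this element is central. The three elements are the
terms with `i = 0` of three families, `p i`, `d i` and `m i`, made of `ωⁱ` and the modes
`F[-i - 1]`. These families obey the commutation relations of `𝔰𝔩₂ ⊗ z ℂ[z]` and the derivation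
`ω ad τ` raises their index (`isSlTwoCurrents`); these relations come from the commutation relations
of the `F_{a,-b}[-r]` alone, collected in `OrthogonalCurrents`, and no central term enters because
all modes are negative.

`IsSlTwoCurrents.gauss` is the resulting identity between `exp z (P + D + M)` and a product
`exp (z p(z)) H(z) exp (z m(z))`, where `H` is the series of the powers of the operator
`D + ω ad τ`, divided by factorials. Both sides satisfy the same first-order differential equation
and have the same constant term.

It remains to expand the factors. The powers of `z p(z)` and `z m(z)` collect the Pfaffians of
`Φ_{-I,I}[-α]` and `Φ_{I,-I}[-α]` over all compositions, and the coefficient `l! / (m_1! m_2! ⋯)`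
counts the compositions with the same parts (`coeff_pow_raising`, `coeff_pow_lowering`); the powers
of `ω` give the subsets `J` (`omega_pow`); and since the `Φ_{i,j}` with `i, j < 0` form a Manin
matrix, the powers of `D + ω ad τ` applied to `1` collect its column determinants
(`phiOp_pow_one`). A product of the words that occur is nonzero only if the subsets partition
`{-n, …, -1}` as required (`exists_subsetData_of_gaussWord_ne_zero`), and then its coefficient at
the top word is the product of the two signs (`SubsetData.topFunctional_gaussWord`).
-/

open Finset
open scoped TensorProduct

noncomputable section

attribute [local instance 100] LieRing.ofAssociativeRing

namespace AffinePfaffian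

/-! ### Exponentials and derivations of power series over a noncommutative ring -/

section PowerSeriesExp

open PowerSeries

variable {A : Type*} [Ring A]

lemma coeff_X_mul_pow_eq_zero (v : A⟦X⟧) {l N : ℕ} (h : N < l) :
    coeff N ((X * v) ^ l) = 0 := by
  rw [(PowerSeries.commute_X v).symm.mul_pow, coeff_X_pow_mul', if_neg (by omega)]

variable [Algebra ℂ A]

/-- The exponential `∑ uˡ / l!` of a power series `u` without constant term. Only the powers with
`l ≤ N` contribute to the coefficient at `N`, so that the sum is cut off there. -/
def expSeries (u : A⟦X⟧) : A⟦X⟧ :=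
  mk fun N => coeff N (∑ l ∈ range (N + 1), ((l.factorial : ℂ)⁻¹) • u ^ l)

lemma coeff_complex_smul (c : ℂ) (f : A⟦X⟧) (N : ℕ) : coeff N (c • f) = c • coeff N f := rfl

lemma coeff_expSeries (v : A⟦X⟧) {N M : ℕ} (h : N < M) :
    coeff N (expSeries (X * v)) =
      coeff N (∑ l ∈ range M, ((l.factorial : ℂ)⁻¹) • (X * v) ^ l) := by
  rw [expSeries, coeff_mk, map_sum, map_sum]
  refine Finset.sum_subset (by simpa using h) fun l _ hl => ?_
  have : coeff N ((X * v) ^ l) = 0 := coeff_X_mul_pow_eq_zero v (by simpa using hl)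
  rw [coeff_complex_smul, this, smul_zero]

/-- A derivation of `A⟦X⟧` that respects the filtration by powers of `X`. -/
structure IsLocalDerivation (Δ : A⟦X⟧ →ₗ[ℂ] A⟦X⟧) : Prop where
  leibniz : ∀ f g, Δ (f * g) = Δ f * g + f * Δ g
  coeff_eq_zero : ∀ f N, (∀ i ≤ N, coeff i f = 0) → coeff N (Δ f) = 0

lemma IsLocalDerivation.map_one {Δ : A⟦X⟧ →ₗ[ℂ] A⟦X⟧} (hΔ : IsLocalDerivation Δ) : Δ 1 = 0 := by
  have h := hΔ.leibniz 1 1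
  rw [mul_one, mul_one, one_mul] at h
  exact left_eq_add.mp h

lemma IsLocalDerivation.map_pow {Δ : A⟦X⟧ →ₗ[ℂ] A⟦X⟧} (hΔ : IsLocalDerivation Δ) {u : A⟦X⟧}
    (hu : Commute u (Δ u)) (l : ℕ) : Δ (u ^ (l + 1)) = ((l + 1 : ℕ) : ℂ) • (Δ u * u ^ l) := by
  induction l with
  | zero => simp
  | succ l ih =>
    rw [pow_succ, hΔ.leibniz, ih, smul_mul_assoc, mul_assoc, ← pow_succ, (hu.pow_left _).eq]
    push_cast
    module

/-- The derivative of an exponential, for an exponent that commutes with its derivative. -/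
lemma IsLocalDerivation.map_expSeries {Δ : A⟦X⟧ →ₗ[ℂ] A⟦X⟧} (hΔ : IsLocalDerivation Δ)
    (v : A⟦X⟧) (hu : Commute (X * v) (Δ (X * v))) :
    Δ (expSeries (X * v)) = Δ (X * v) * expSeries (X * v) := by
  ext N
  set S : ℕ → A⟦X⟧ := fun M => ∑ l ∈ range M, ((l.factorial : ℂ)⁻¹) • (X * v) ^ l with hS
  have h1 : coeff N (Δ (expSeries (X * v))) = coeff N (Δ (S (N + 2))) := by
    rw [← sub_eq_zero, ← map_sub, ← map_sub]
    refine hΔ.coeff_eq_zero _ N fun i hi => ?_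
    rw [map_sub, sub_eq_zero]
    exact coeff_expSeries v (by omega)
  have h2 : Δ (S (N + 2)) = Δ (X * v) * S (N + 1) := by
    rw [hS]
    simp only
    rw [Finset.sum_range_succ', map_add, map_sum, pow_zero, map_smul, hΔ.map_one, smul_zero,
      add_zero, Finset.mul_sum]
    refine Finset.sum_congr rfl fun l _ => ?_
    rw [map_smul, hΔ.map_pow hu, smul_smul, mul_smul_comm, Nat.factorial_succ]
    congr 1
    have h3 : ((l + 1 : ℕ) : ℂ) ≠ 0 := Nat.cast_ne_zero.mpr (by omega)
    have h4 : (l.factorial : ℂ) ≠ 0 := Nat.cast_ne_zero.mpr l.factorial_ne_zero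
    push_cast at h3 ⊢
    field_simp
  rw [h1, h2, coeff_mul, coeff_mul]
  refine Finset.sum_congr rfl fun ij hij => ?_
  rw [HasAntidiagonal.mem_antidiagonal] at hij
  rw [coeff_expSeries v (show ij.2 < N + 1 by omega)]

/-- The Euler derivation `X d/dX`. -/
def euler (A : Type*) [Ring A] [Algebra ℂ A] : A⟦X⟧ →ₗ[ℂ] A⟦X⟧ where
  toFun f := mk fun N => (N : ℂ) • coeff N f
  map_add' f g := by ext N; simp
  map_smul' c f := by
    ext N
    rw [coeff_mk, RingHom.id_apply, coeff_complex_smul, coeff_complex_smul, coeff_mk, smul_comm]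

@[simp] lemma coeff_euler (f : A⟦X⟧) (N : ℕ) : coeff N (euler A f) = (N : ℂ) • coeff N f :=
  coeff_mk N fun N => (N : ℂ) • coeff N f

lemma euler_isLocalDerivation : IsLocalDerivation (euler A) where
  leibniz f g := by
    ext N
    rw [coeff_euler, map_add, coeff_mul, coeff_mul, coeff_mul, Finset.smul_sum,
      ← Finset.sum_add_distrib]
    refine Finset.sum_congr rfl fun ij hij => ?_
    rw [HasAntidiagonal.mem_antidiagonal] at hij
    rw [coeff_euler, coeff_euler, ← hij, smul_mul_assoc, mul_smul_comm]
    push_cast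
    module
  coeff_eq_zero f N h := by rw [coeff_euler, h N le_rfl, smul_zero]

/-- A linear endomorphism of `A`, applied to the coefficients of a power series. -/
def mapCoeff (T : A →ₗ[ℂ] A) : A⟦X⟧ →ₗ[ℂ] A⟦X⟧ where
  toFun f := mk fun N => T (coeff N f)
  map_add' f g := by ext N; simp
  map_smul' c f := by
    ext N
    rw [coeff_mk, RingHom.id_apply, coeff_complex_smul, coeff_complex_smul, coeff_mk, map_smul]

@[simp] lemma coeff_mapCoeff (T : A →ₗ[ℂ] A) (f : A⟦X⟧) (N : ℕ) :
    coeff N (mapCoeff T f) = T (coeff N f) :=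
  coeff_mk N fun N => T (coeff N f)

lemma mapCoeff_isLocalDerivation {T : A →ₗ[ℂ] A} (hT : ∀ x y, T (x * y) = T x * y + x * T y) :
    IsLocalDerivation (mapCoeff T) where
  leibniz f g := by
    ext N
    rw [coeff_mapCoeff, map_add, coeff_mul, coeff_mul, coeff_mul, map_sum,
      ← Finset.sum_add_distrib]
    refine Finset.sum_congr rfl fun ij _ => ?_
    rw [coeff_mapCoeff, coeff_mapCoeff, hT]
  coeff_eq_zero f N h := by rw [coeff_mapCoeff, h N le_rfl, map_zero]

/-- The inner derivation `f ↦ f y - y f`. -/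
def innerDer (y : A⟦X⟧) : A⟦X⟧ →ₗ[ℂ] A⟦X⟧ := LinearMap.mulRight ℂ y - LinearMap.mulLeft ℂ y

lemma innerDer_apply (y f : A⟦X⟧) : innerDer y f = f * y - y * f := rfl

lemma innerDer_isLocalDerivation (y : A⟦X⟧) : IsLocalDerivation (innerDer y) where
  leibniz f g := by simp only [innerDer_apply]; noncomm_ring
  coeff_eq_zero f N h := by
    rw [innerDer_apply, map_sub, coeff_mul, coeff_mul, Finset.sum_eq_zero, Finset.sum_eq_zero,
      sub_zero]
    · intro ij hij
      rw [HasAntidiagonal.mem_antidiagonal] at hij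
      rw [h _ (by omega), mul_zero]
    · intro ij hij
      rw [HasAntidiagonal.mem_antidiagonal] at hij
      rw [h _ (by omega), zero_mul]

/-- The equation `X dW/dX = X g W` has only the zero solution with `W(0) = 0`. -/
lemma eq_zero_of_euler_eq {W g : A⟦X⟧} (h : euler A W = X * g * W) (h0 : coeff 0 W = 0) :
    W = 0 := by
  ext N
  rw [map_zero]
  induction N using Nat.strong_induction_on with
  | _ N ih =>
    rcases N with _ | N
    · exact h0
    have h1 := congrArg (coeff (N + 1)) h
    rw [coeff_euler, mul_assoc, coeff_succ_X_mul, coeff_mul, Finset.sum_eq_zero] at h1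
    · exact (smul_eq_zero.mp h1).resolve_left (Nat.cast_ne_zero.mpr (by omega))
    · intro ij hij
      rw [HasAntidiagonal.mem_antidiagonal] at hij
      rw [ih _ (by omega), mul_zero]

lemma coeff_zero_expSeries (v : A⟦X⟧) : coeff 0 (expSeries (X * v)) = 1 := by
  rw [coeff_expSeries v (Nat.zero_lt_one)]
  simp

end PowerSeriesExp

/-! ### Gauss decomposition for currents with values in `𝔰𝔩₂` -/

section Gauss

open PowerSeries

variable {A : Type*} [Ring A]

lemma commute_mk {f g : ℕ → A} (h : ∀ i j, Commute (f i) (g j)) :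
    Commute (PowerSeries.mk f) (PowerSeries.mk g) := by
  change PowerSeries.mk f * PowerSeries.mk g = PowerSeries.mk g * PowerSeries.mk f
  ext N
  rw [coeff_mul, coeff_mul, ← Finset.Nat.sum_antidiagonal_swap]
  refine Finset.sum_congr rfl fun ij _ => ?_
  simpa using (h ij.2 ij.1).eq

lemma mk_mul_mk_sub (f g : ℕ → A) :
    PowerSeries.mk f * PowerSeries.mk g - PowerSeries.mk g * PowerSeries.mk f =
    PowerSeries.mk fun N => ∑ ij ∈ antidiagonal N, (f ij.1 * g ij.2 - g ij.2 * f ij.1) := by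
  ext N
  rw [map_sub, coeff_mul, coeff_mul, coeff_mk, Finset.sum_sub_distrib]
  congr 1
  · simp
  · rw [← Finset.Nat.sum_antidiagonal_swap]
    simp

lemma mk_mul_C_sub (f : ℕ → A) (a : A) : PowerSeries.mk f * C a - C a * PowerSeries.mk f =
    PowerSeries.mk fun N => f N * a - a * f N := by
  ext N
  rw [map_sub, coeff_mul_C, coeff_C_mul, coeff_mk, coeff_mk]

lemma X_mul_left_comm (f g : A⟦X⟧) : f * (X * g) = X * (f * g) := by
  rw [← mul_assoc, ← X_mul, mul_assoc]

lemma Commute.X_mul_X_mul {f g : A⟦X⟧} (h : Commute f g) : Commute (X * f) (X * g) := by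
  change X * f * (X * g) = X * g * (X * f)
  rw [mul_assoc, mul_assoc, X_mul_left_comm f g, X_mul_left_comm g f, h.eq]

variable [Algebra ℂ A]

lemma euler_X_mul (f : A⟦X⟧) : euler A (X * f) = X * f + X * euler A f := by
  rw [euler_isLocalDerivation.leibniz]
  congr 2
  ext N
  rw [coeff_euler, coeff_X]
  split_ifs with h
  · simp [h]
  · simp

lemma euler_X_mul_mk (f : ℕ → A) :
    euler A (X * PowerSeries.mk f) = X * PowerSeries.mk fun i => ((i + 1 : ℕ) : ℂ) • f i := by
  rw [euler_X_mul, ← mul_add]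
  congr 1
  ext N
  simp only [map_add, coeff_euler, coeff_mk]
  push_cast
  rw [add_smul, one_smul, add_comm]

lemma euler_C (a : A) : euler A (C a) = 0 := by
  ext N
  rw [coeff_euler, coeff_C]
  split_ifs with h <;> simp [h]

/-- Elements `p i`, `d i`, `m i` with the commutation relations of `e zⁱ⁺¹`, `h zⁱ⁺¹`, `-f zⁱ⁺¹`
in `𝔰𝔩₂[z]`, together with a derivation `T` that acts on the `d i` as `z² d/dz`. -/
structure IsSlTwoCurrents (p d m : ℕ → A) (T : A →ₗ[ℂ] A) : Prop where
  comm_p : ∀ i j, Commute (p i) (p j)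
  comm_d : ∀ i j, Commute (d i) (d j)
  comm_m : ∀ i j, Commute (m i) (m j)
  lie_p_m : ∀ i j, p i * m j - m j * p i = -d (i + j + 1)
  lie_d_p : ∀ i j, d i * p j - p j * d i = (2 : ℂ) • p (i + j + 1)
  lie_d_m : ∀ i j, d i * m j - m j * d i = -((2 : ℂ) • m (i + j + 1))
  T_mul : ∀ x y, T (x * y) = T x * y + x * T y
  T_d : ∀ i, T (d i) = ((i + 1 : ℕ) : ℂ) • d (i + 1)

namespace IsSlTwoCurrents

variable {p d m : ℕ → A} {T : A →ₗ[ℂ] A} (hc : IsSlTwoCurrents p d m T)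
include hc

lemma lie_p_d (i j : ℕ) : p i * d j - d j * p i = -((2 : ℂ) • p (i + j + 1)) := by
  rw [← neg_sub, hc.lie_d_p, add_comm j i]

lemma euler_exp_p : euler A (expSeries (X * PowerSeries.mk p)) =
    X * (PowerSeries.mk fun i => ((i + 1 : ℕ) : ℂ) • p i) * expSeries (X * PowerSeries.mk p) := by
  rw [euler_isLocalDerivation.map_expSeries, euler_X_mul_mk]
  rw [euler_X_mul_mk]
  exact Commute.X_mul_X_mul (commute_mk fun i j => (hc.comm_p i j).smul_right _)

lemma euler_exp_m : euler A (expSeries (X * PowerSeries.mk m)) =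
    X * (PowerSeries.mk fun i => ((i + 1 : ℕ) : ℂ) • m i) * expSeries (X * PowerSeries.mk m) := by
  rw [euler_isLocalDerivation.map_expSeries, euler_X_mul_mk]
  rw [euler_X_mul_mk]
  exact Commute.X_mul_X_mul (commute_mk fun i j => (hc.comm_m i j).smul_right _)

lemma exp_p_mul_d : expSeries (X * PowerSeries.mk p) * (X * PowerSeries.mk d) =
    (X * PowerSeries.mk d +
      X * (X * PowerSeries.mk fun i => -((2 * (i + 1 : ℕ) : ℂ) • p (i + 1)))) *
      expSeries (X * PowerSeries.mk p) := by
  have h : innerDer (X * PowerSeries.mk d) (X * PowerSeries.mk p) =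
      X * (X * PowerSeries.mk fun i => -((2 * (i + 1 : ℕ) : ℂ) • p (i + 1))) := by
    rw [innerDer_apply, mul_assoc, mul_assoc, X_mul_left_comm, X_mul_left_comm (PowerSeries.mk d),
      ← mul_sub, ← mul_sub, mk_mul_mk_sub]
    congr 3
    ext N
    rw [Finset.sum_congr rfl (g := fun _ => -((2 : ℂ) • p (N + 1))), Finset.sum_const,
      Finset.Nat.card_antidiagonal, ← Nat.cast_smul_eq_nsmul ℂ]
    · module
    · intro ij hij
      rw [HasAntidiagonal.mem_antidiagonal] at hij
      rw [hc.lie_p_d, hij]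
  have h1 := (innerDer_isLocalDerivation (X * PowerSeries.mk d)).map_expSeries
    (PowerSeries.mk p) (by
    rw [h]
    refine Commute.X_mul_X_mul ?_
    refine (PowerSeries.commute_X _).mul_right (commute_mk fun i j => ?_)
    exact ((hc.comm_p i (j + 1)).smul_right _).neg_right)
  rw [h, innerDer_apply] at h1
  rw [add_mul, ← h1]
  abel

/-- Conjugation of `m 0` by the exponential of the `p i`. The difference of the two sides solves a
homogeneous first-order equation without constant term. -/
lemma exp_p_mul_m : expSeries (X * PowerSeries.mk p) * C (m 0) =
    (C (m 0) + X * (PowerSeries.mk fun i => -d (i + 1)) +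
      X * (X * PowerSeries.mk fun i => ((i + 1 : ℕ) : ℂ) • p (i + 2))) *
        expSeries (X * PowerSeries.mk p) := by
  have hg := hc.euler_exp_p
  set U := expSeries (X * PowerSeries.mk p) with hU
  set g : A⟦X⟧ := PowerSeries.mk fun i => ((i + 1 : ℕ) : ℂ) • p i with hgdef
  set c : A⟦X⟧ := PowerSeries.mk fun i => -d (i + 1) with hcdef
  set k : A⟦X⟧ := PowerSeries.mk fun i => ((i + 1 : ℕ) : ℂ) • p (i + 2) with hkdef
  have h1 : g * C (m 0) - C (m 0) * g = PowerSeries.mk fun i => ((i + 1 : ℕ) : ℂ) • -d (i + 1) := by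
    rw [mk_mul_C_sub]
    congr 1
    ext N
    rw [smul_mul_assoc, mul_smul_comm, ← smul_sub, hc.lie_p_m, add_zero]
  have h2 : g * c - c * g =
      PowerSeries.mk fun i => ((i + 2 : ℕ) : ℂ) • ((i + 1 : ℕ) : ℂ) • p (i + 2) := by
    rw [mk_mul_mk_sub]
    congr 1
    ext N
    rw [Finset.sum_congr rfl (g := fun ij => ((2 * (ij.1 + 1) : ℕ) : ℂ) • p (N + 2)),
      ← Finset.sum_smul, ← Nat.cast_sum, smul_smul, ← Nat.cast_mul]
    · congr 2
      rw [Finset.Nat.sum_antidiagonal_eq_sum_range_succ (fun i _ => 2 * (i + 1))]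
      clear_value U g c k
      induction N with
      | zero => rfl
      | succ N ih => rw [Finset.sum_range_succ, ih]; ring
    · intro ij hij
      rw [HasAntidiagonal.mem_antidiagonal] at hij
      rw [smul_mul_assoc, mul_smul_comm, ← smul_sub, mul_neg, neg_mul, ← neg_sub', hc.lie_p_d,
        neg_neg, smul_smul, show ij.1 + (ij.2 + 1) + 1 = N + 2 by omega]
      push_cast
      module
  have h3 : g * k = k * g :=
    (commute_mk fun i j => ((hc.comm_p i (j + 2)).smul_left _).smul_right _ : Commute g k)
  have hθc : euler A (X * c) = X * PowerSeries.mk fun i => ((i + 1 : ℕ) : ℂ) • -d (i + 1) :=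
    euler_X_mul_mk _
  have hθk : euler A (X * (X * k)) =
      X * (X * PowerSeries.mk fun i => ((i + 2 : ℕ) : ℂ) • ((i + 1 : ℕ) : ℂ) • p (i + 2)) := by
    rw [euler_X_mul, euler_X_mul_mk, ← mul_add, ← mul_add]
    congr 2
    ext N
    simp only [map_add, coeff_mk, hkdef]
    push_cast
    module
  rw [← h1] at hθc
  rw [← h2] at hθk
  rw [← sub_eq_zero]
  refine eq_zero_of_euler_eq (g := g) ?_ ?_
  · rw [map_sub, euler_isLocalDerivation.leibniz, euler_isLocalDerivation.leibniz, map_add,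
      map_add, euler_C, hθc, hθk, hg]
    have e1 : X * (g * c - c * g) = g * (X * c) - (X * c) * g := by
      rw [X_mul_left_comm, mul_assoc, mul_sub]
    have e2 : X * (X * k) * g = g * (X * (X * k)) := by
      rw [X_mul_left_comm g, X_mul_left_comm g, mul_assoc, mul_assoc, h3]
    have e3 : ∀ f : A⟦X⟧, f * (X * g * U) = X * (f * g * U) := fun f => by
      rw [mul_assoc, X_mul_left_comm, mul_assoc]
    rw [e3, e1, add_mul _ _ g, add_mul _ _ g, e2]
    noncomm_ring
  · rw [map_sub, coeff_mul_C, coeff_zero_eq_constantCoeff_apply,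
      coeff_zero_eq_constantCoeff_apply, map_mul, ← coeff_zero_eq_constantCoeff_apply U, hU,
      coeff_zero_expSeries]
    simp

/-- The solution of `(k + 1) H (k + 1) = d 0 H k + T (H k)` is an exponential. -/
lemma mk_eq_exp_d {H : ℕ → A} (H0 : H 0 = 1)
    (HS : ∀ k, ((k + 1 : ℕ) : ℂ) • H (k + 1) = d 0 * H k + T (H k)) :
    PowerSeries.mk H = expSeries (X * PowerSeries.mk fun i => ((i + 1 : ℕ) : ℂ)⁻¹ • d i) := by
  set v : A⟦X⟧ := PowerSeries.mk fun i => ((i + 1 : ℕ) : ℂ)⁻¹ • d i with hv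
  have hθ : euler A (X * v) = X * PowerSeries.mk d := by
    rw [euler_X_mul_mk]
    congr 2
    ext i
    rw [smul_smul, mul_inv_cancel₀ (Nat.cast_ne_zero.mpr (by omega)), one_smul]
  have hT : X * mapCoeff T (X * v) = X * PowerSeries.mk d - X * C (d 0) := by
    rw [← mul_sub]
    congr 1
    ext N
    rcases N with _ | N
    · simp
    · rw [coeff_mapCoeff, coeff_succ_X_mul, coeff_mk, map_smul, hc.T_d, smul_smul,
        inv_mul_cancel₀ (Nat.cast_ne_zero.mpr (by omega)), one_smul, map_sub, coeff_mk,
        coeff_succ_C, sub_zero]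
  have e1 := euler_isLocalDerivation.map_expSeries v (by
    rw [hθ]
    exact Commute.X_mul_X_mul (commute_mk fun i j => (hc.comm_d i j).smul_left _))
  have e2 := (mapCoeff_isLocalDerivation hc.T_mul).map_expSeries v (by
    have : mapCoeff T (X * v) = X * PowerSeries.mk fun i => d (i + 1) := by
      ext N
      rcases N with _ | N
      · simp
      · rw [coeff_mapCoeff, coeff_succ_X_mul, coeff_succ_X_mul, coeff_mk, coeff_mk, map_smul,
          hc.T_d, smul_smul, inv_mul_cancel₀ (Nat.cast_ne_zero.mpr (by omega)), one_smul]
    rw [this]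
    exact Commute.X_mul_X_mul (commute_mk fun i j => (hc.comm_d i (j + 1)).smul_left _))
  have e3 : euler A (expSeries (X * v)) =
      X * (C (d 0) * expSeries (X * v)) + X * mapCoeff T (expSeries (X * v)) := by
    rw [e1, e2, ← mul_assoc X (mapCoeff T (X * v)), hT, hθ]
    noncomm_ring
  ext N
  induction N with
  | zero => rw [coeff_mk, H0, coeff_zero_expSeries]
  | succ N ih =>
    have h := congrArg (coeff (N + 1)) e3
    rw [coeff_euler, map_add, coeff_succ_X_mul, coeff_succ_X_mul, coeff_C_mul, coeff_mapCoeff,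
      ← ih, coeff_mk, ← HS] at h
    rw [coeff_mk]
    exact (smul_right_injective A (Nat.cast_ne_zero.mpr (by omega : N + 1 ≠ 0)) h).symm

lemma euler_exp_d {H : ℕ → A} (H0 : H 0 = 1)
    (HS : ∀ k, ((k + 1 : ℕ) : ℂ) • H (k + 1) = d 0 * H k + T (H k)) :
    euler A (PowerSeries.mk H) = X * PowerSeries.mk d * PowerSeries.mk H := by
  have hθ : euler A (X * PowerSeries.mk fun i => ((i + 1 : ℕ) : ℂ)⁻¹ • d i) =
      X * PowerSeries.mk d := by
    rw [euler_X_mul_mk]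
    congr 2
    ext i
    rw [smul_smul, mul_inv_cancel₀ (Nat.cast_ne_zero.mpr (by omega)), one_smul]
  rw [hc.mk_eq_exp_d H0 HS, euler_isLocalDerivation.map_expSeries, hθ]
  rw [hθ]
  exact Commute.X_mul_X_mul (commute_mk fun i j => (hc.comm_d i j).smul_left _)

/-- Conjugation of `m k` by the exponential of the `d i`: it amounts to multiplication by
`(1 - z)²` in `𝔰𝔩₂[z]`. -/
lemma exp_d_mul_m {H : A⟦X⟧} (H0 : coeff 0 H = 1)
    (hH : euler A H = X * PowerSeries.mk d * H) (k : ℕ) :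
    H * C (m k) = (C (m k) - (2 : ℂ) • (X * C (m (k + 1))) + X * (X * C (m (k + 2)))) * H := by
  set z : A⟦X⟧ := C (m k) - (2 : ℂ) • (X * C (m (k + 1))) + X * (X * C (m (k + 2))) with hz
  have hθ : euler A z = X * (PowerSeries.mk d * z - z * PowerSeries.mk d) := by
    have e : PowerSeries.mk d * z - z * PowerSeries.mk d =
        (PowerSeries.mk d * C (m k) - C (m k) * PowerSeries.mk d) -
        (2 : ℂ) • (X * (PowerSeries.mk d * C (m (k + 1)) - C (m (k + 1)) * PowerSeries.mk d)) +
        X * (X * (PowerSeries.mk d * C (m (k + 2)) - C (m (k + 2)) * PowerSeries.mk d)) := by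
      rw [hz, mul_add, mul_sub, mul_smul_comm, X_mul_left_comm, X_mul_left_comm, X_mul_left_comm,
        add_mul, sub_mul, smul_mul_assoc]
      simp only [mul_assoc, mul_sub, smul_sub]
      abel
    rw [e, mk_mul_C_sub, mk_mul_C_sub, mk_mul_C_sub, hz, map_add, map_sub, map_smul, euler_X_mul,
      euler_X_mul, euler_X_mul, euler_C, euler_C, euler_C]
    simp only [hc.lie_d_m]
    ext N
    rcases N with _ | _ | _ | N
    · simp
    · simp
    · simp only [map_add, map_sub, mul_zero, add_zero, coeff_complex_smul, coeff_succ_X_mul,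
        coeff_mk, zero_sub, map_neg, coeff_zero_C, coeff_succ_C, smul_zero, zero_add, neg_zero,
        coeff_zero_X_mul, mul_add]
      rw [show 1 + k + 1 = 0 + (k + 1) + 1 by omega, show 0 + (k + 1) + 1 = k + 2 by omega]
      module
    · simp only [map_add, map_sub, mul_zero, add_zero, coeff_complex_smul, coeff_succ_X_mul,
        coeff_mk, zero_sub, map_neg, coeff_succ_C, smul_zero, neg_zero, mul_add]
      rw [show N + 1 + 1 + k + 1 = N + k + 3 by omega,
        show N + 1 + (k + 1) + 1 = N + k + 3 by omega, show N + (k + 2) + 1 = N + k + 3 by omega]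
      module
  rw [← sub_eq_zero]
  refine eq_zero_of_euler_eq (g := PowerSeries.mk d) ?_ ?_
  · rw [map_sub, euler_isLocalDerivation.leibniz, euler_isLocalDerivation.leibniz, euler_C, hH, hθ]
    have e3 : z * (X * PowerSeries.mk d * H) = X * (z * PowerSeries.mk d * H) := by
      rw [mul_assoc, X_mul_left_comm, mul_assoc]
    rw [e3]
    noncomm_ring
  · have h0 : constantCoeff z = m k := by
      rw [← coeff_zero_eq_constantCoeff_apply, hz]
      simp
    rw [map_sub, coeff_mul_C, coeff_zero_eq_constantCoeff_apply (z * H), map_mul, h0,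
      ← coeff_zero_eq_constantCoeff_apply H, H0, one_mul, mul_one, sub_self]

/-- The logarithmic derivative of the exponential of the `m i`, conjugated by that of the `d i`. -/
lemma exp_d_mul_exp_m {H : A⟦X⟧} (H0 : coeff 0 H = 1) (hH : euler A H = X * PowerSeries.mk d * H) :
    H * (X * PowerSeries.mk fun i => ((i + 1 : ℕ) : ℂ) • m i) = X * (C (m 0) * H) := by
  rw [X_mul_left_comm]
  congr 1
  ext N
  set b : ℕ → A := fun r => coeff N (X ^ r * (C (m r) * H)) with hb
  have hb0 : ∀ r, N < r → b r = 0 := fun r hr => by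
    rw [hb]
    simp only
    rw [coeff_X_pow_mul', if_neg (by omega)]
  have h1 : ∀ ij ∈ antidiagonal N, coeff ij.1 H * (((ij.2 + 1 : ℕ) : ℂ) • m ij.2) =
      ((ij.2 + 1 : ℕ) : ℂ) • (b ij.2 - (2 : ℂ) • b (ij.2 + 1) + b (ij.2 + 2)) := by
    intro ij hij
    rw [HasAntidiagonal.mem_antidiagonal] at hij
    rw [mul_smul_comm, ← coeff_mul_C, hc.exp_d_mul_m H0 hH, ← coeff_X_pow_mul _ ij.2 ij.1, hij]
    simp only [hb]
    rw [← coeff_complex_smul 2, ← map_sub, ← map_add]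
    congr 2
    rw [pow_succ, pow_succ, pow_succ]
    simp only [add_mul, sub_mul, mul_add, mul_sub, smul_mul_assoc, mul_smul_comm, mul_assoc]
  -- Summation by parts: the second differences of `b` are paired with a linear sequence.
  have h2 : ∀ M, ∑ r ∈ range M, ((r + 1 : ℕ) : ℂ) • (b r - (2 : ℂ) • b (r + 1) + b (r + 2)) =
      b 0 - ((M + 1 : ℕ) : ℂ) • b M + (M : ℂ) • b (M + 1) := by
    intro M
    induction M with
    | zero => simp
    | succ M ih =>
      rw [Finset.sum_range_succ, ih]
      push_cast
      module
  rw [coeff_mul]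
  simp only [coeff_mk]
  rw [Finset.sum_congr rfl h1, ← Finset.Nat.sum_antidiagonal_swap,
    Finset.Nat.sum_antidiagonal_eq_sum_range_succ_mk]
  simp only [Prod.swap_prod_mk]
  rw [h2, hb0 (N + 1) (by omega), hb0 (N + 1 + 1) (by omega), smul_zero, smul_zero, sub_zero,
    add_zero]
  simp [hb]

/-- The exponential of `e + h - f` (a nilpotent element of `𝔰𝔩₂`) times `z`, decomposed as
upper unitriangular times diagonal times lower unitriangular. -/
theorem gauss {H : ℕ → A} (H0 : H 0 = 1)
    (HS : ∀ k, ((k + 1 : ℕ) : ℂ) • H (k + 1) = d 0 * H k + T (H k)) (N : ℕ) :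
    (p 0 + d 0 + m 0) ^ N = (N.factorial : ℂ) •
      coeff N (expSeries (X * PowerSeries.mk p) * PowerSeries.mk H *
        expSeries (X * PowerSeries.mk m)) := by
  have hθH := hc.euler_exp_d H0 HS
  have e1 := hc.euler_exp_p
  have e2 := hc.exp_p_mul_d
  have e3 := hc.exp_p_mul_m
  have e4 := hc.exp_d_mul_exp_m (H := PowerSeries.mk H) (by rw [coeff_mk, H0]) hθH
  have e5 := hc.euler_exp_m
  have hU0 : coeff 0 (expSeries (X * PowerSeries.mk p)) = 1 := coeff_zero_expSeries _
  have hL0 : coeff 0 (expSeries (X * PowerSeries.mk m)) = 1 := coeff_zero_expSeries _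
  set U := expSeries (X * PowerSeries.mk p)
  set L := expSeries (X * PowerSeries.mk m)
  -- The logarithmic derivatives of the three factors, moved to the left, add up to the exponent.
  have key : (X * PowerSeries.mk fun i => ((i + 1 : ℕ) : ℂ) • p i) +
      (X * PowerSeries.mk d +
        X * (X * PowerSeries.mk fun i => -((2 * (i + 1 : ℕ) : ℂ) • p (i + 1)))) +
      X * (C (m 0) + X * (PowerSeries.mk fun i => -d (i + 1)) +
      X * (X * PowerSeries.mk fun i => ((i + 1 : ℕ) : ℂ) • p (i + 2))) =
      X * C (p 0 + d 0 + m 0) := by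
    rw [← mul_add, ← mul_add, ← mul_add]
    congr 1
    ext n
    rcases n with _ | _ | n
    · simp
    · simp
      module
    · simp only [map_add, coeff_mk, coeff_succ_X_mul, coeff_succ_C]
      rw [show n + 1 + 1 = n + 2 from rfl]
      push_cast
      module
  have hθ : euler A (U * PowerSeries.mk H * L) =
      X * C (p 0 + d 0 + m 0) * (U * PowerSeries.mk H * L) := by
    rw [euler_isLocalDerivation.leibniz, euler_isLocalDerivation.leibniz, e1, hθH, e5,
      ← mul_assoc (U * PowerSeries.mk H), mul_assoc U (PowerSeries.mk H) (X * _), e4,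
      ← mul_assoc U (X * PowerSeries.mk d), e2,
      X_mul_left_comm U, ← mul_assoc U (C _), e3, ← key]
    noncomm_ring
  clear_value U L
  induction N with
  | zero =>
    rw [coeff_zero_eq_constantCoeff_apply] at hU0 hL0 ⊢
    rw [map_mul, map_mul, hU0, hL0, constantCoeff_mk, H0]
    simp
  | succ N ih =>
    have h := congrArg (coeff (N + 1)) hθ
    rw [coeff_euler, mul_assoc X, coeff_succ_X_mul, coeff_C_mul] at h
    rw [pow_succ', ih, mul_smul_comm, ← h, smul_smul, Nat.factorial_succ]
    push_cast
    rw [mul_comm]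

end IsSlTwoCurrents

end Gauss

/-! ### Powers of power series and partitions -/

section Partitions

open PowerSeries

lemma PartitionOfLength.list_ofFn_part {B : Type*} {a l : ℕ} (α : PartitionOfLength a l)
    (f : ℕ → B) : (List.ofFn fun k => f (α.part k)) = (α.1.parts.sort (· ≥ ·)).map f := by
  refine List.ext_getElem (by rw [List.length_ofFn, List.length_map, Multiset.length_sort, α.2])
    fun i h1 h2 => ?_
  simp [PartitionOfLength.part]

/-- The coefficient `l! / (m_1! m_2! ⋯)` counts the compositions with the parts of `α`. -/
lemma PartitionOfLength.coeff_eq_countPerms {a l : ℕ} (α : PartitionOfLength a l) :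
    α.coeff = (α.1.parts.countPerms : ℂ) := by
  have h := Nat.multinomial_spec α.1.parts.toFinset (fun s => α.1.parts.count s)
  rw [Multiset.toFinset_sum_count_eq, α.2] at h
  have h0 : (∏ s ∈ α.1.parts.toFinset, ((α.1.parts.count s).factorial : ℂ)) ≠ 0 :=
    Finset.prod_ne_zero_iff.mpr fun s _ => Nat.cast_ne_zero.mpr (Nat.factorial_ne_zero _)
  rw [PartitionOfLength.coeff, div_eq_iff h0, ← h]
  push_cast
  rw [mul_comm]
  rfl

lemma PartitionOfLength.length_le {a l : ℕ} (α : PartitionOfLength a l) : l ≤ a := by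
  have h := Multiset.card_nsmul_le_sum (s := α.1.parts) (a := 1) fun x hx => α.1.parts_pos hx
  rwa [α.2, α.1.parts_sum, smul_eq_mul, mul_one] at h

lemma PartitionOfLength.part_pos {a l : ℕ} (α : PartitionOfLength a l) (k : Fin l) :
    0 < α.part k :=
  α.1.parts_pos ((Multiset.mem_sort (· ≥ ·)).mp (List.get_mem _ _))

lemma PartitionOfLength.sum_part {a l : ℕ} (α : PartitionOfLength a l) :
    ∑ k, α.part k = a := by
  rw [← List.sum_ofFn, α.list_ofFn_part fun x => x, List.map_id', ← Multiset.sum_coe,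
    Multiset.sort_eq, α.1.parts_sum]

variable {A : Type*} [Ring A]

lemma coeff_pow_congr {f g : A⟦X⟧} {N : ℕ} (h : ∀ i ≤ N, coeff i f = coeff i g) (l : ℕ) :
    ∀ i ≤ N, coeff i (f ^ l) = coeff i (g ^ l) := by
  induction l with
  | zero => simp
  | succ l ih =>
    intro i hi
    rw [pow_succ, pow_succ, coeff_mul, coeff_mul]
    refine Finset.sum_congr rfl fun ij hij => ?_
    rw [HasAntidiagonal.mem_antidiagonal] at hij
    rw [ih _ (by omega), h _ (by omega)]

lemma list_prod_map_C_mul_X_pow (p : ℕ → A) (s : List ℕ) :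
    (s.map fun r => C (p r) * X ^ r).prod = C (s.map p).prod * X ^ s.sum := by
  induction s with
  | nil => simp
  | cons r s ih =>
    rw [List.map_cons, List.prod_cons, ih, List.map_cons, List.prod_cons, List.sum_cons, map_mul,
      pow_add, mul_assoc, mul_assoc, ← mul_assoc (X ^ r), X_pow_mul, mul_assoc]

/-- The multinomial theorem for a power series with commuting coefficients, grouped by the
partitions of the exponent. -/
lemma coeff_X_mul_mk_pow [Algebra ℂ A] {p : ℕ → A} (hp : ∀ i j, Commute (p i) (p j)) (a l : ℕ) :
    coeff a ((X * PowerSeries.mk p) ^ l) =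
      ∑ α : PartitionOfLength a l, α.coeff • (List.ofFn fun k => p (α.part k - 1)).prod := by
  set x : ℕ → A⟦X⟧ := fun r => C (p (r - 1)) * X ^ r with hx
  have hcomm : ∀ i j, Commute (x i) (x j) := fun i j =>
    ((((hp _ _).map C).mul_right (commute_X_pow _ _))).mul_left
      ((commute_X_pow _ _).symm)
  have h1 : ∀ i ≤ a, coeff i (X * PowerSeries.mk p) = coeff i (∑ r ∈ Icc 1 a, x r) := by
    intro i hi
    rw [map_sum]
    simp only [hx, coeff_C_mul, coeff_X_pow, mul_ite, mul_one, mul_zero]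
    rw [Finset.sum_ite_eq]
    rcases i with _ | i
    · simp
    · rw [coeff_succ_X_mul, coeff_mk, if_pos (by simp; omega), Nat.add_sub_cancel]
  rw [coeff_pow_congr h1 l a le_rfl, Finset.sum_pow_of_commute _ _ (fun i _ j _ _ => hcomm i j),
    map_sum]
  have h2 : ∀ (s : Multiset ℕ) (hs), coeff a ((s.countPerms : A⟦X⟧) *
      (s.map x).noncommProd hs) =
      if s.sum = a then (s.countPerms : ℂ) • ((s.sort (· ≥ ·)).map fun r => p (r - 1)).prod
      else 0 := by
    intro s hs
    have h3 : (s.map x).noncommProd hs = C ((s.sort (· ≥ ·)).map fun r => p (r - 1)).prod *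
        X ^ s.sum := by
      have h4 := list_prod_map_C_mul_X_pow (fun r => p (r - 1)) (s.sort (· ≥ ·))
      rw [← Multiset.sum_coe, Multiset.sort_eq] at h4
      have h5 : ∀ (t : Multiset A⟦X⟧) (ht) (L : List A⟦X⟧), t = L → t.noncommProd ht = L.prod := by
        rintro _ ht L rfl
        exact Multiset.noncommProd_coe _ _
      rw [← h4]
      exact h5 _ _ _ (by rw [← Multiset.map_coe, Multiset.sort_eq])
    rw [h3, ← nsmul_eq_mul, map_nsmul, coeff_C_mul, coeff_X_pow, Nat.cast_smul_eq_nsmul]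
    split_ifs with h5 h6 h6
    · rw [mul_one]
    · exact absurd h5.symm h6
    · exact absurd h6.symm h5
    · rw [mul_zero, smul_zero]
  refine (Finset.sum_of_injOn (fun α : PartitionOfLength a l =>
    (⟨⟨α.1.parts, α.2⟩, Finset.mem_sym_iff.mpr fun i hi => Finset.mem_Icc.mpr
      ⟨α.1.parts_pos hi, α.1.le_of_mem_parts hi⟩⟩ : (Icc 1 a).sym l)) ?_ ?_ ?_ ?_).symm
  · intro α _ β _ h
    exact Subtype.ext (Nat.Partition.ext (congrArg (fun k => k.1.1) h))
  · exact fun _ _ => Finset.mem_coe.mpr (Finset.mem_univ _)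
  · intro k _ hk
    rw [h2, if_neg]
    intro hsum
    refine hk ⟨⟨⟨k.1.1, fun {i} hi => (Finset.mem_Icc.mp (Finset.mem_sym_iff.mp k.2 i hi)).1, hsum⟩,
      k.1.2⟩, by simp, rfl⟩
  · intro α _
    rw [h2, if_pos α.1.parts_sum, α.coeff_eq_countPerms, α.list_ofFn_part fun r => p (r - 1)]

end Partitions

/-! ### Words in the exterior algebra -/

section Words

variable {n : ℕ}

/-- The exterior algebra on generators `e i` indexed by `[-n; n]`. -/
abbrev Ext (n : ℕ) : Type := ExteriorAlgebra ℂ (Idx n → ℂ)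

/-- The generator `e i`. -/
def extGen (i : Idx n) : Ext n := ExteriorAlgebra.ι ℂ (Pi.single i 1)

/-- The product of the generators along a string of indices. -/
def extWord (s : List (Idx n)) : Ext n := (s.map extGen).prod

@[simp] lemma extWord_nil : extWord ([] : List (Idx n)) = 1 := rfl

lemma extWord_cons (i : Idx n) (s : List (Idx n)) : extWord (i :: s) = extGen i * extWord s := by
  rw [extWord, List.map_cons, List.prod_cons, extWord]

lemma extWord_append (s t : List (Idx n)) : extWord (s ++ t) = extWord s * extWord t := by
  rw [extWord, List.map_append, List.prod_append, extWord, extWord]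

lemma extWord_concat (s : List (Idx n)) (i : Idx n) :
    extWord (s ++ [i]) = extWord s * extGen i := by
  rw [extWord_append, extWord_cons, extWord_nil, mul_one]

lemma extGen_mul_extGen (i j : Idx n) : extGen i * extGen j = -(extGen j * extGen i) :=
  eq_neg_of_add_eq_zero_left (ExteriorAlgebra.ι_add_mul_swap _ _)

/-- Products of two generators are central. -/
lemma commute_extGen_mul_extGen (i j : Idx n) (x : Ext n) : Commute (extGen i * extGen j) x := by
  have h : ∀ a b c : Ext n, a * b = -(b * a) → a * c = -(c * a) → b * c = -(c * b) →
      a * b * c = c * (a * b) := fun a b c _ hac hbc => by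
    rw [mul_assoc, hbc, mul_neg, ← mul_assoc, hac, neg_mul, neg_neg, mul_assoc]
  have hι : ∀ v w : Idx n → ℂ, ExteriorAlgebra.ι ℂ v * ExteriorAlgebra.ι ℂ w =
      -(ExteriorAlgebra.ι ℂ w * ExteriorAlgebra.ι ℂ v) := fun v w =>
    eq_neg_of_add_eq_zero_left (ExteriorAlgebra.ι_add_mul_swap _ _)
  induction x using ExteriorAlgebra.induction with
  | algebraMap r => exact (Algebra.commutes r _).symm
  | ι v => exact h _ _ _ (hι _ _) (hι _ _) (hι _ _)
  | mul a b ha hb => exact ha.mul_right hb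
  | add a b ha hb => exact ha.add_right hb

/-- Words of even length are central. -/
lemma commute_extWord_of_even : ∀ (s : List (Idx n)), Even s.length → ∀ x, Commute (extWord s) x
  | [], _, x => Commute.one_left x
  | [_], h, _ => absurd h (by simp)
  | i :: j :: s, h, x => by
    rw [extWord_cons, extWord_cons, ← mul_assoc]
    refine (commute_extGen_mul_extGen i j x).mul_left (commute_extWord_of_even s ?_ x)
    simpa [Nat.even_add_one] using h

lemma extWord_ofFn {m : ℕ} (f : Fin m → Idx n) :
    extWord (List.ofFn f) = ExteriorAlgebra.ιMulti ℂ m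
      fun k => (Pi.single (f k) 1 : Idx n → ℂ) := by
  rw [ExteriorAlgebra.ιMulti_apply, extWord, List.map_ofFn]
  rfl

lemma extWord_ofFn_comp {m : ℕ} (f : Fin m → Idx n) (σ : Equiv.Perm (Fin m)) :
    extWord (List.ofFn fun k => f (σ k)) = (Equiv.Perm.sign σ : ℤ) • extWord (List.ofFn f) := by
  rw [extWord_ofFn, extWord_ofFn]
  exact (ExteriorAlgebra.ιMulti ℂ m).map_perm (fun k => (Pi.single (f k) 1 : Idx n → ℂ)) σ

lemma extWord_ofFn_eq_zero {m : ℕ} {f : Fin m → Idx n} (hf : ¬ Function.Injective f) :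
    extWord (List.ofFn f) = 0 := by
  rw [extWord_ofFn]
  refine (ExteriorAlgebra.ιMulti ℂ m).map_eq_zero_of_not_injective _ fun h => hf fun i j hij => ?_
  exact h (by simp only [hij])

lemma extWord_eq_zero {s : List (Idx n)} (hs : ¬ s.Nodup) : extWord s = 0 := by
  rw [← List.ofFn_get s]
  exact extWord_ofFn_eq_zero fun h => hs (List.nodup_iff_injective_get.mpr h)

lemma extWord_reverse_ofFn_comp {m : ℕ} (f : Fin m → Idx n) (σ : Equiv.Perm (Fin m)) :
    extWord (List.ofFn fun k => f (σ k)).reverse =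
      (Equiv.Perm.sign σ : ℤ) • extWord (List.ofFn f).reverse := by
  have h : ∀ g : Fin m → Idx n, (List.ofFn g).reverse = List.ofFn fun k => g k.rev := fun g =>
    List.ext_getElem (by simp) fun i h1 h2 => by
      simp only [List.getElem_reverse, List.getElem_ofFn, List.length_ofFn]
      congr 1
      ext
      simp only [Fin.val_rev]
      omega
  rw [h, h]
  have h2 := extWord_ofFn_comp (fun k : Fin m => f k.rev)
    (Fin.revPerm.symm.trans (Equiv.trans σ Fin.revPerm))
  have h3 : Equiv.Perm.sign (Fin.revPerm.symm.trans (Equiv.trans σ Fin.revPerm)) =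
      Equiv.Perm.sign σ := Equiv.Perm.sign_symm_trans_trans σ Fin.revPerm
  rw [h3] at h2
  rw [← h2]
  simp

/-- A word is the sign of its string times the sorted word. -/
lemma extWord_eq_stringSign_smul {s t : List (Idx n)} (hst : s.Perm t)
    (ht : t.Pairwise (· ≤ ·)) : extWord s = stringSign s • extWord t := by
  have h1 : List.ofFn (fun k => s.get (Tuple.sort s.get k)) = t := by
    refine List.Perm.eq_of_pairwise (le := (· ≤ ·)) (fun a b _ _ => le_antisymm) ?_ ht ?_
    · exact List.pairwise_ofFn.mpr fun i j hij => Tuple.monotone_sort s.get hij.le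
    · refine List.Perm.trans ?_ hst
      have h2 := (Tuple.sort s.get).ofFn_comp_perm s.get
      rwa [List.ofFn_get] at h2
  have h2 := extWord_ofFn_comp s.get (Tuple.sort s.get)
  rw [h1, List.ofFn_get] at h2
  rw [h2, stringSign, smul_smul, ← Units.val_mul, Int.units_mul_self, Units.val_one, one_smul]

/-- The product of generators `e (f k) e (g k)`, sorted into a word in the `e (f k)` and a reversed
word in the `e (g k)`. -/
lemma prod_ofFn_extGen_mul_extGen : ∀ {m : ℕ} (f g : Fin m → Idx n),
    (List.ofFn fun k => extGen (f k) * extGen (g k)).prod =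
      extWord (List.ofFn f) * extWord (List.ofFn g).reverse
  | 0, _, _ => by simp
  | m + 1, f, g => by
    rw [List.ofFn_succ, List.ofFn_succ (f := f), List.ofFn_succ (f := g), List.prod_cons,
      prod_ofFn_extGen_mul_extGen, extWord_cons, List.reverse_cons, extWord_concat, mul_assoc,
      mul_assoc, ← extWord_append, ← mul_assoc (extWord _), ← extWord_append]
    congr 1
    exact ((commute_extWord_of_even _ (by simp) _).symm).eq

/-- The subset `{1, …, n}` of `[-n; n]`. -/
def positives (n : ℕ) : Finset (Idx n) := univ.filter fun i => 0 < i.1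

lemma increasing_pairwise (I : Finset (Idx n)) : (increasing I).Pairwise (· ≤ ·) :=
  I.pairwise_sort (· ≤ ·)

lemma mem_negatives {i : Idx n} : i ∈ negatives n ↔ i.1 < 0 := by simp [negatives]

lemma mem_positives {i : Idx n} : i ∈ positives n ↔ 0 < i.1 := by simp [positives]

lemma increasing_univ :
    increasing (univ : Finset (Idx n)) = increasing (negatives n) ++ increasing (positives n) := by
  refine List.Perm.eq_of_pairwise (le := (· ≤ ·)) (fun a b _ _ => le_antisymm)
    (increasing_pairwise _) ?_ ?_
  · rw [List.pairwise_append]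
    refine ⟨increasing_pairwise _, increasing_pairwise _, fun a ha b hb => ?_⟩
    rw [increasing, Finset.mem_sort, mem_negatives] at ha
    rw [increasing, Finset.mem_sort, mem_positives] at hb
    exact Subtype.coe_le_coe.mp (ha.trans hb).le
  · refine (List.perm_ext_iff_of_nodup (Finset.sort_nodup _ _) ?_).mpr ?_
    rotate_left
    · intro a
      have h0 : a.1 ≠ 0 := (Finset.mem_erase.mp a.2).1
      simp only [increasing, List.mem_append, Finset.mem_sort, mem_negatives, mem_positives,
        Finset.mem_univ, true_iff]
      omega
    · refine (Finset.sort_nodup _ _).append (Finset.sort_nodup _ _) fun a ha hb => ?_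
      rw [Finset.mem_sort, mem_negatives] at ha
      rw [increasing, Finset.mem_sort, mem_positives] at hb
      omega

lemma ofFn_orderEmbOfFin {m : ℕ} (I : Finset (Idx n)) (h : #I = m) :
    List.ofFn (I.orderEmbOfFin h) = increasing I := by
  refine List.ext_getElem (by simp [increasing, h]) fun i h1 h2 => ?_
  simp [increasing, Finset.orderEmbOfFin_apply]

/-- The coefficient of the top word: a linear functional, given by the determinant. -/
lemma exists_topFunctional (n : ℕ) :
    ∃ ε : Ext n →ₗ[ℂ] ℂ, ε (extWord (increasing (univ : Finset (Idx n)))) = 1 := by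
  let o := ((univ : Finset (Idx n)).orderIsoOfFin rfl).toEquiv.trans
    (Equiv.subtypeUnivEquiv Finset.mem_univ)
  refine ⟨ExteriorAlgebra.liftAlternating (Function.update 0 #(univ : Finset (Idx n))
    ((Pi.basisFun ℂ (Idx n)).det.domDomCongr o.symm)), ?_⟩
  rw [← ofFn_orderEmbOfFin _ rfl, extWord_ofFn, ExteriorAlgebra.liftAlternating_apply_ιMulti,
    Function.update_self, AlternatingMap.domDomCongr_apply]
  refine Eq.trans (congrArg _ (funext fun i => ?_)) (Pi.basisFun ℂ (Idx n)).det_self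
  rw [Pi.basisFun_apply]
  change (Pi.single (o (o.symm i)) 1 : Idx n → ℂ) = _
  rw [Equiv.apply_symm_apply]

end Words

/-! ### Sums over functions and over subsets -/

section Subsets

variable {ι : Type*} [LinearOrder ι]

/-- The increasing enumeration of a subset of size `m`. -/
def subsetEnum {m : ℕ} {S : Finset ι} (I : {I : Finset ι // I ∈ powersetCard m S}) : Fin m → ι :=
  I.1.orderEmbOfFin (mem_powersetCard.mp I.2).2

lemma subsetEnum_mem {m : ℕ} {S : Finset ι} (I : {I : Finset ι // I ∈ powersetCard m S})
    (k : Fin m) : subsetEnum I k ∈ I.1 :=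
  Finset.orderEmbOfFin_mem _ _ _

lemma subsetEnum_injective {m : ℕ} {S : Finset ι} (I : {I : Finset ι // I ∈ powersetCard m S}) :
    Function.Injective (subsetEnum I) :=
  (I.1.orderEmbOfFin _).injective

/-- An injective function on `Fin m` is the increasing enumeration of a subset up to a
permutation. -/
lemma sum_piFinset_eq_sum_powersetCard {W : Type*} [AddCommMonoid W] {m : ℕ} (S : Finset ι)
    (Z : (Fin m → ι) → W) (hZ : ∀ f, ¬ Function.Injective f → Z f = 0) :
    ∑ f ∈ Fintype.piFinset (fun _ => S), Z f =
      ∑ I : {I : Finset ι // I ∈ powersetCard m S}, ∑ σ : Equiv.Perm (Fin m),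
        Z fun k => subsetEnum I (σ k) := by
  rw [← Fintype.sum_prod_type']
  symm
  have himage : ∀ (I : {I : Finset ι // I ∈ powersetCard m S}) (σ : Equiv.Perm (Fin m)) (x : ι),
      x ∈ I.1 ↔ ∃ k, subsetEnum I (σ k) = x := by
    intro I σ x
    have h : Set.range (subsetEnum I) = (I.1 : Set ι) := Finset.range_orderEmbOfFin _ _
    rw [← Finset.mem_coe, ← h]
    exact ⟨fun ⟨k, hk⟩ => ⟨σ.symm k, by rw [Equiv.apply_symm_apply, hk]⟩, fun ⟨k, hk⟩ => ⟨_, hk⟩⟩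
  refine Finset.sum_of_injOn (fun (p : {I : Finset ι // I ∈ powersetCard m S} ×
    Equiv.Perm (Fin m)) => fun k => subsetEnum p.1 (p.2 k)) ?_ ?_ ?_ fun _ _ => rfl
  · rintro ⟨I, σ⟩ _ ⟨I', σ'⟩ _ h
    have hI : I = I' := Subtype.ext (Finset.ext fun x => by
      rw [himage I σ, himage I' σ']
      exact exists_congr fun k => by rw [show subsetEnum I (σ k) = _ from congrFun h k])
    subst hI
    refine Prod.ext rfl (Equiv.ext fun k => ?_)
    exact subsetEnum_injective I (congrFun h k)
  · rintro ⟨I, σ⟩ _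
    rw [Finset.mem_coe, Fintype.mem_piFinset]
    exact fun k => (mem_powersetCard.mp I.2).1 (subsetEnum_mem I _)
  · intro f hf hf'
    refine hZ f fun hinj => hf' ?_
    have hI : Finset.univ.image f ∈ powersetCard m S := by
      rw [mem_powersetCard, Finset.card_image_of_injective _ hinj]
      refine ⟨fun x hx => ?_, by simp⟩
      obtain ⟨k, _, rfl⟩ := Finset.mem_image.mp hx
      exact Fintype.mem_piFinset.mp hf k
    have hex : ∀ k, ∃ j, subsetEnum ⟨_, hI⟩ j = f k := fun k =>
      (himage ⟨_, hI⟩ 1 _).mp (Finset.mem_image_of_mem f (Finset.mem_univ k))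
    choose g hg using hex
    have hginj : Function.Injective g := fun a b hab => hinj (by rw [← hg, ← hg, hab])
    exact ⟨(⟨_, hI⟩, Equiv.ofBijective g (Finite.injective_iff_bijective.mp hginj)), by simp,
      funext hg⟩

/-- The sum over functions of a symmetric expression that vanishes on noninjective functions. -/
lemma sum_piFinset_of_symmetric {W : Type*} [AddCommGroup W] [Module ℂ W] {m : ℕ} (S : Finset ι)
    (Z : (Fin m → ι) → W) (hZ : ∀ f, ¬ Function.Injective f → Z f = 0)
    (hσ : ∀ f (σ : Equiv.Perm (Fin m)), Z (fun k => f (σ k)) = Z f) :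
    ∑ f ∈ Fintype.piFinset (fun _ => S), Z f =
      (m.factorial : ℂ) • ∑ I : {I : Finset ι // I ∈ powersetCard m S}, Z (subsetEnum I) := by
  rw [sum_piFinset_eq_sum_powersetCard S Z hZ, Finset.smul_sum]
  refine Finset.sum_congr rfl fun I _ => ?_
  simp only [hσ]
  rw [Finset.sum_const, Finset.card_univ, Fintype.card_perm, Fintype.card_fin,
    Nat.cast_smul_eq_nsmul]

/-- The sum over functions of a word times a coefficient, grouped by subsets. -/
lemma sum_extWord_tmul {n m : ℕ} {R : Type*} [Ring R] [Algebra ℂ R] (S : Finset ι)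
    {x : ι → Idx n} (c : (Fin m → ι) → R) :
    ∑ f ∈ Fintype.piFinset (fun _ => S), extWord (List.ofFn fun k => x (f k)) ⊗ₜ[ℂ] c f =
      ∑ I : {I : Finset ι // I ∈ powersetCard m S},
        extWord (List.ofFn fun k => x (subsetEnum I k)) ⊗ₜ[ℂ]
          ∑ σ : Equiv.Perm (Fin m), (Equiv.Perm.sign σ : ℤ) • c fun k => subsetEnum I (σ k) := by
  rw [sum_piFinset_eq_sum_powersetCard]
  · refine Finset.sum_congr rfl fun I _ => ?_
    rw [TensorProduct.tmul_sum]
    refine Finset.sum_congr rfl fun σ _ => ?_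
    rw [extWord_ofFn_comp (fun k => x (subsetEnum I k)) σ, ← Int.cast_smul_eq_zsmul ℂ,
      ← Int.cast_smul_eq_zsmul ℂ, TensorProduct.smul_tmul]
  · intro f hf
    rw [extWord_ofFn_eq_zero, TensorProduct.zero_tmul]
    exact fun h => hf fun i j hij => h (by simp only [hij])

end Subsets

/-! ### Generating elements for the orthogonal currents -/

section Currents

variable {n : ℕ}

section SumOrder

variable {ι B : Type*} (S S' Q Q' : Finset ι)

lemma sum_sum_mul_sum_sum [NonUnitalNonAssocSemiring B] (x y : ι → ι → B) :
    (∑ a ∈ S, ∑ b ∈ S', x a b) * (∑ c ∈ Q, ∑ d ∈ Q', y c d) =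
      ∑ a ∈ S, ∑ b ∈ S', ∑ c ∈ Q, ∑ d ∈ Q', x a b * y c d := by
  simp_rw [Finset.sum_mul, Finset.mul_sum]

variable [AddCommMonoid B] (F : ι → ι → ι → ι → B)

lemma sum_order_acbd : ∑ a ∈ S, ∑ c ∈ Q, ∑ b ∈ S', ∑ d ∈ Q', F a c b d =
    ∑ a ∈ S, ∑ b ∈ S', ∑ c ∈ Q, ∑ d ∈ Q', F a c b d :=
  Finset.sum_congr rfl fun _ _ => Finset.sum_comm

lemma sum_order_bcad : ∑ b ∈ S', ∑ c ∈ Q, ∑ a ∈ S, ∑ d ∈ Q', F b c a d =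
    ∑ a ∈ S, ∑ b ∈ S', ∑ c ∈ Q, ∑ d ∈ Q', F b c a d :=
  (Finset.sum_congr rfl fun _ _ => Finset.sum_comm).trans Finset.sum_comm

lemma sum_order_adbc : ∑ a ∈ S, ∑ d ∈ Q', ∑ b ∈ S', ∑ c ∈ Q, F a d b c =
    ∑ a ∈ S, ∑ b ∈ S', ∑ c ∈ Q, ∑ d ∈ Q', F a d b c :=
  Finset.sum_congr rfl fun _ _ =>
    Finset.sum_comm.trans (Finset.sum_congr rfl fun _ _ => Finset.sum_comm)

lemma sum_order_bdac : ∑ b ∈ S', ∑ d ∈ Q', ∑ a ∈ S, ∑ c ∈ Q, F b d a c =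
    ∑ a ∈ S, ∑ b ∈ S', ∑ c ∈ Q, ∑ d ∈ Q', F b d a c :=
  (sum_order_adbc S' S Q Q' F).trans Finset.sum_comm

lemma sum_order_cdab : ∑ c ∈ Q, ∑ d ∈ Q', ∑ a ∈ S, ∑ b ∈ S', F c d a b =
    ∑ a ∈ S, ∑ b ∈ S', ∑ c ∈ Q, ∑ d ∈ Q', F c d a b :=
  (Finset.sum_congr rfl fun _ _ => Finset.sum_comm.trans
    (Finset.sum_congr rfl fun _ _ => Finset.sum_comm)).trans
    (Finset.sum_comm.trans (Finset.sum_congr rfl fun _ _ => Finset.sum_comm))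

end SumOrder

/-- Elements `G a b r` of a ring with the antisymmetry and the commutation relations of
`F_{a,-b}[-r]`, and a derivation `τ` that acts on them as `ad τ`. -/
structure OrthogonalCurrents (n : ℕ) (R : Type*) [Ring R] [Algebra ℂ R] where
  /-- The element that stands for `F_{a,-b}[-r]`. -/
  G : Idx n → Idx n → ℕ → R
  /-- The derivation that stands for `ad τ`. -/
  τ : R →ₗ[ℂ] R
  antisymm : ∀ a b r, G a b r = -G b a r
  lie : ∀ a b c d r s, G a b r * G c d s - G c d s * G a b r =
    (if b.neg = c then G a d (r + s) else 0) - (if a.neg = c then G b d (r + s) else 0) -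
      (if b.neg = d then G a c (r + s) else 0) + (if a.neg = d then G b c (r + s) else 0)
  τ_mul : ∀ x y, τ (x * y) = τ x * y + x * τ y
  τ_G : ∀ a b r, τ (G a b r) = (r : ℂ) • G a b (r + 1)

/-- The sum of `e b e c` over the `b ∈ S` and `c ∈ S'` with `c = -b`. -/
def pairing (S S' : Finset (Idx n)) : Ext n :=
  ∑ b ∈ S, ∑ c ∈ S', if b.neg = c then extGen b * extGen c else 0

/-- The element `∑ e i e (-i)`, the sum over `i ∈ {-n, …, -1}`. -/
def omega (n : ℕ) : Ext n := ∑ b ∈ negatives n, extGen b * extGen b.neg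

lemma neg_mem_positives {i : Idx n} : i.neg ∈ positives n ↔ i ∈ negatives n := by
  rw [mem_positives, mem_negatives]
  exact neg_pos

lemma neg_mem_negatives {i : Idx n} : i.neg ∈ negatives n ↔ i ∈ positives n := by
  rw [mem_positives, mem_negatives]
  exact neg_lt_zero

lemma not_mem_positives_of_mem_negatives {i : Idx n} (h : i ∈ negatives n) : i ∉ positives n := by
  rw [mem_positives]
  rw [mem_negatives] at h
  exact h.le.not_gt

lemma pairing_negatives_positives : pairing (negatives n) (positives n) = omega n := by
  refine Finset.sum_congr rfl fun b hb => ?_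
  rw [Finset.sum_ite_eq, if_pos (neg_mem_positives.mpr hb)]

lemma pairing_positives_negatives : pairing (positives n) (negatives n) = -omega n := by
  rw [pairing, omega, ← Finset.sum_neg_distrib]
  refine Finset.sum_bij' (fun b _ => b.neg) (fun b _ => b.neg)
    (fun b hb => neg_mem_negatives.mpr hb) (fun b hb => neg_mem_positives.mpr hb)
    (fun b _ => b.neg_neg) (fun b _ => b.neg_neg) fun b hb => ?_
  rw [Finset.sum_ite_eq, if_pos (neg_mem_negatives.mpr hb), extGen_mul_extGen, Idx.neg_neg]

lemma pairing_negatives_negatives : pairing (negatives n) (negatives n) = 0 := by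
  refine Finset.sum_eq_zero fun b hb => ?_
  rw [Finset.sum_ite_eq, if_neg]
  exact fun h => not_mem_positives_of_mem_negatives hb (neg_mem_negatives.mp h)

lemma pairing_positives_positives : pairing (positives n) (positives n) = 0 := by
  refine Finset.sum_eq_zero fun b hb => ?_
  rw [Finset.sum_ite_eq, if_neg]
  exact fun h => not_mem_positives_of_mem_negatives (neg_mem_positives.mp h) hb

lemma commute_omega (x : Ext n) : Commute (omega n) x :=
  Commute.sum_left _ _ _ fun _ _ => commute_extGen_mul_extGen _ _ _

variable {R : Type*} [Ring R] [Algebra ℂ R]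

lemma commute_tmul_one {w : Ext n} (hw : ∀ x, Commute w x) (y : Ext n ⊗[ℂ] R) :
    Commute (w ⊗ₜ[ℂ] (1 : R)) y := by
  induction y using TensorProduct.induction_on with
  | zero => exact Commute.zero_right _
  | tmul v r =>
    change w ⊗ₜ[ℂ] (1 : R) * v ⊗ₜ[ℂ] r = v ⊗ₜ[ℂ] r * w ⊗ₜ[ℂ] (1 : R)
    rw [Algebra.TensorProduct.tmul_mul_tmul, Algebra.TensorProduct.tmul_mul_tmul, (hw v).eq,
      one_mul, mul_one]
  | add a b ha hb => exact ha.add_right hb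

variable (n R) in
/-- The element `∑ e i e (-i)` in the tensor product with `R`. -/
def omegaT : Ext n ⊗[ℂ] R := omega n ⊗ₜ 1

lemma commute_omegaT (y : Ext n ⊗[ℂ] R) : Commute (omegaT n R) y :=
  commute_tmul_one commute_omega y

namespace OrthogonalCurrents

variable (Γ : OrthogonalCurrents n R)

/-- The element `∑ e a e b ⊗ G a b r`, the sum over `a ∈ S` and `b ∈ S'`. -/
def pairSum (S S' : Finset (Idx n)) (r : ℕ) : Ext n ⊗[ℂ] R :=
  ∑ a ∈ S, ∑ b ∈ S', (extGen a * extGen b) ⊗ₜ Γ.G a b r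

lemma pairSum_swap (S S' : Finset (Idx n)) (r : ℕ) : Γ.pairSum S S' r = Γ.pairSum S' S r := by
  rw [pairSum, pairSum, Finset.sum_comm]
  refine Finset.sum_congr rfl fun b _ => Finset.sum_congr rfl fun a _ => ?_
  rw [extGen_mul_extGen, Γ.antisymm, TensorProduct.neg_tmul, TensorProduct.tmul_neg, neg_neg]

lemma lie_pairSum_term (a b c d : Idx n) (r s : ℕ) :
    (extGen a * extGen b) ⊗ₜ[ℂ] Γ.G a b r * (extGen c * extGen d) ⊗ₜ[ℂ] Γ.G c d s -
      (extGen c * extGen d) ⊗ₜ[ℂ] Γ.G c d s * (extGen a * extGen b) ⊗ₜ[ℂ] Γ.G a b r =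
    (if b.neg = c then extGen b * extGen c else 0) ⊗ₜ[ℂ] (1 : R) *
        (extGen a * extGen d) ⊗ₜ[ℂ] Γ.G a d (r + s) +
      (if a.neg = c then extGen a * extGen c else 0) ⊗ₜ[ℂ] (1 : R) *
        (extGen b * extGen d) ⊗ₜ[ℂ] Γ.G b d (r + s) +
      (if b.neg = d then extGen b * extGen d else 0) ⊗ₜ[ℂ] (1 : R) *
        (extGen a * extGen c) ⊗ₜ[ℂ] Γ.G a c (r + s) +
      (if a.neg = d then extGen a * extGen d else 0) ⊗ₜ[ℂ] (1 : R) *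
        (extGen b * extGen c) ⊗ₜ[ℂ] Γ.G b c (r + s) := by
  have h0 : extGen c * extGen d * (extGen a * extGen b) =
      extGen a * extGen b * (extGen c * extGen d) := (commute_extGen_mul_extGen c d _).eq
  have h1 : extGen b * extGen c * (extGen a * extGen d) =
      extGen a * extGen b * (extGen c * extGen d) := by
    rw [← mul_assoc, (commute_extGen_mul_extGen b c (extGen a)).eq]
    simp only [mul_assoc]
  have h2 : extGen a * extGen c * (extGen b * extGen d) =
      -(extGen a * extGen b * (extGen c * extGen d)) := by
    rw [mul_assoc, ← mul_assoc (extGen c), extGen_mul_extGen c b]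
    simp only [neg_mul, mul_neg, mul_assoc]
  have h3 : extGen b * extGen d * (extGen a * extGen c) =
      -(extGen a * extGen b * (extGen c * extGen d)) := by
    rw [(commute_extGen_mul_extGen b d _).eq, h2]
  have h4 : extGen a * extGen d * (extGen b * extGen c) =
      extGen a * extGen b * (extGen c * extGen d) := by
    rw [(commute_extGen_mul_extGen a d _).eq, h1]
  simp only [Algebra.TensorProduct.tmul_mul_tmul, ite_mul, zero_mul, one_mul, h0, h1, h2, h3, h4]
  rw [← TensorProduct.tmul_sub, Γ.lie, TensorProduct.tmul_add, TensorProduct.tmul_sub,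
    TensorProduct.tmul_sub]
  congr 1
  · rw [sub_eq_add_neg, sub_eq_add_neg]
    congr 1
    · congr 1
      · split_ifs <;> simp
      · split_ifs <;> simp [TensorProduct.neg_tmul]
    · split_ifs <;> simp [TensorProduct.neg_tmul]
  · split_ifs <;> simp

/-- The commutator of two sums `∑ e a e b ⊗ G a b r`: each term contracts one index of the first
factor with one index of the second. -/
lemma lie_pairSum (S S' Q Q' : Finset (Idx n)) (r s : ℕ) :
    Γ.pairSum S S' r * Γ.pairSum Q Q' s - Γ.pairSum Q Q' s * Γ.pairSum S S' r =
      pairing S' Q ⊗ₜ 1 * Γ.pairSum S Q' (r + s) + pairing S Q ⊗ₜ 1 * Γ.pairSum S' Q' (r + s) +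
      pairing S' Q' ⊗ₜ 1 * Γ.pairSum S Q (r + s) +
      pairing S Q' ⊗ₜ 1 * Γ.pairSum S' Q (r + s) := by
  simp only [pairing, pairSum, TensorProduct.sum_tmul, sum_sum_mul_sum_sum]
  -- each of the five other products of double sums is brought to the order `a`, `b`, `c`, `d`
  rw [sum_order_cdab S S' Q Q', sum_order_bcad S S' Q Q', sum_order_acbd S S' Q Q',
    sum_order_bdac S S' Q Q', sum_order_adbc S S' Q Q']
  simp only [← Finset.sum_sub_distrib, ← Finset.sum_add_distrib]
  refine Finset.sum_congr rfl fun a _ => Finset.sum_congr rfl fun b _ =>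
    Finset.sum_congr rfl fun c _ => Finset.sum_congr rfl fun d _ => ?_
  exact Γ.lie_pairSum_term a b c d r s

end OrthogonalCurrents

end Currents

/-! ### The generating elements as currents with values in `𝔰𝔩₂` -/

section GeneratingElements

variable {n : ℕ} {R : Type*} [Ring R] [Algebra ℂ R]

namespace OrthogonalCurrents

variable (Γ : OrthogonalCurrents n R)

/-- The element `ωⁱ P[i + 1]`, where `P[r]` collects the `F_{-i,j}[-r]` with `i, j < 0`. -/
def raising (i : ℕ) : Ext n ⊗[ℂ] R :=
  omegaT n R ^ i * ((2 : ℂ)⁻¹ • Γ.pairSum (positives n) (positives n) (i + 1))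

/-- The element `ωⁱ D[i + 1]`, where `D[r]` collects the `F_{i,j}[-r]` with `i, j < 0`. -/
def diagonal (i : ℕ) : Ext n ⊗[ℂ] R :=
  omegaT n R ^ i * Γ.pairSum (negatives n) (positives n) (i + 1)

/-- The element `ωⁱ M[i + 1]`, where `M[r]` collects the `F_{i,-j}[-r]` with `i, j < 0`. -/
def lowering (i : ℕ) : Ext n ⊗[ℂ] R :=
  omegaT n R ^ i * ((2 : ℂ)⁻¹ • Γ.pairSum (negatives n) (negatives n) (i + 1))

/-- The operator `id ⊗ τ`. -/
def tauT : Ext n ⊗[ℂ] R →ₗ[ℂ] Ext n ⊗[ℂ] R := Γ.τ.lTensor (Ext n)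

lemma tauT_tmul (w : Ext n) (x : R) : Γ.tauT (w ⊗ₜ x) = w ⊗ₜ Γ.τ x := LinearMap.lTensor_tmul _ _ _ _

lemma tauT_mul (x y : Ext n ⊗[ℂ] R) : Γ.tauT (x * y) = Γ.tauT x * y + x * Γ.tauT y := by
  induction x using TensorProduct.induction_on with
  | zero => simp
  | add a b ha hb => rw [add_mul, map_add, ha, hb, map_add, add_mul, add_mul]; abel
  | tmul v r =>
    induction y using TensorProduct.induction_on with
    | zero => simp
    | add a b ha hb => rw [mul_add, map_add, ha, hb, map_add, mul_add, mul_add]; abel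
    | tmul w s =>
      simp only [Algebra.TensorProduct.tmul_mul_tmul, tauT_tmul, Γ.τ_mul, TensorProduct.tmul_add]

lemma τ_one : Γ.τ 1 = 0 := by
  have h := Γ.τ_mul 1 1
  rw [mul_one, mul_one, one_mul] at h
  exact left_eq_add.mp h

lemma tauT_omegaT_mul (x : Ext n ⊗[ℂ] R) :
    Γ.tauT (omegaT n R * x) = omegaT n R * Γ.tauT x := by
  rw [tauT_mul, omegaT, tauT_tmul, τ_one, TensorProduct.tmul_zero, zero_mul, zero_add]

lemma tauT_omegaT_pow_mul (i : ℕ) (x : Ext n ⊗[ℂ] R) :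
    Γ.tauT (omegaT n R ^ i * x) = omegaT n R ^ i * Γ.tauT x := by
  induction i with
  | zero => simp
  | succ i ih => rw [pow_succ', mul_assoc, tauT_omegaT_mul, ih, mul_assoc]

/-- The derivation `ω (id ⊗ τ)`. -/
def omegaTau : Ext n ⊗[ℂ] R →ₗ[ℂ] Ext n ⊗[ℂ] R :=
  LinearMap.mulLeft ℂ (omegaT n R) ∘ₗ Γ.tauT

lemma omegaTau_apply (x : Ext n ⊗[ℂ] R) : Γ.omegaTau x = omegaT n R * Γ.tauT x := rfl

lemma tauT_pairSum (S S' : Finset (Idx n)) (r : ℕ) :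
    Γ.tauT (Γ.pairSum S S' r) = (r : ℂ) • Γ.pairSum S S' (r + 1) := by
  simp only [pairSum, map_sum, tauT_tmul, Γ.τ_G, TensorProduct.tmul_smul, Finset.smul_sum]

lemma omegaT_pow_mul_mul (i j : ℕ) (x y : Ext n ⊗[ℂ] R) :
    omegaT n R ^ i * x * (omegaT n R ^ j * y) = omegaT n R ^ (i + j) * (x * y) := by
  rw [mul_assoc, ← mul_assoc x, ← ((commute_omegaT x).pow_left j).eq, pow_add]
  simp only [mul_assoc]

lemma omegaT_pow_lie (i j : ℕ) (x y : Ext n ⊗[ℂ] R) :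
    omegaT n R ^ i * x * (omegaT n R ^ j * y) - omegaT n R ^ j * y * (omegaT n R ^ i * x) =
      omegaT n R ^ (i + j) * (x * y - y * x) := by
  rw [omegaT_pow_mul_mul, omegaT_pow_mul_mul, add_comm j i, mul_sub]

/-- The Howe dual `𝔰𝔩₂`: the generating elements obey its commutation relations. -/
lemma isSlTwoCurrents : IsSlTwoCurrents Γ.raising Γ.diagonal Γ.lowering Γ.omegaTau where
  comm_p i j := by
    refine sub_eq_zero.mp ?_
    rw [raising, raising, omegaT_pow_lie, smul_mul_smul_comm, smul_mul_smul_comm, ← smul_sub,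
      lie_pairSum, pairing_positives_positives]
    simp
  comm_m i j := by
    refine sub_eq_zero.mp ?_
    rw [lowering, lowering, omegaT_pow_lie, smul_mul_smul_comm, smul_mul_smul_comm, ← smul_sub,
      lie_pairSum, pairing_negatives_negatives]
    simp
  comm_d i j := by
    refine sub_eq_zero.mp ?_
    rw [diagonal, diagonal, omegaT_pow_lie, lie_pairSum, pairing_positives_positives,
      pairing_negatives_negatives, pairing_positives_negatives, pairing_negatives_positives,
      Γ.pairSum_swap (positives n) (negatives n), TensorProduct.neg_tmul]
    simp
  lie_p_m i j := by
    rw [raising, lowering, omegaT_pow_lie, smul_mul_smul_comm, smul_mul_smul_comm, ← smul_sub,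
      lie_pairSum, pairing_positives_negatives, Γ.pairSum_swap (positives n) (negatives n),
      TensorProduct.neg_tmul, diagonal, pow_succ,
      show i + 1 + (j + 1) = i + j + 1 + 1 by omega, omegaT]
    simp only [neg_mul, mul_smul_comm, mul_neg, mul_add, mul_assoc]
    module
  lie_d_p i j := by
    rw [raising, diagonal, omegaT_pow_lie, mul_smul_comm, smul_mul_assoc, ← smul_sub,
      lie_pairSum, pairing_negatives_positives, pairing_positives_positives, raising, pow_succ,
      show i + 1 + (j + 1) = i + j + 1 + 1 by omega, omegaT, TensorProduct.zero_tmul]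
    simp only [zero_mul, mul_smul_comm, mul_assoc, zero_add, add_zero, mul_add]
    module
  lie_d_m i j := by
    rw [lowering, diagonal, omegaT_pow_lie, mul_smul_comm, smul_mul_assoc, ← smul_sub,
      lie_pairSum, pairing_positives_negatives, pairing_negatives_negatives, lowering, pow_succ,
      show i + 1 + (j + 1) = i + j + 1 + 1 by omega, omegaT, TensorProduct.zero_tmul,
      TensorProduct.neg_tmul]
    simp only [zero_mul, mul_smul_comm, mul_assoc, add_zero, mul_add, neg_mul, mul_neg]
    module
  T_mul x y := by
    rw [omegaTau_apply, omegaTau_apply, omegaTau_apply, tauT_mul, mul_add, mul_assoc,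
      ← mul_assoc x, ← (commute_omegaT x).eq, mul_assoc]
  T_d i := by
    rw [omegaTau_apply, diagonal, tauT_omegaT_pow_mul, tauT_pairSum, diagonal, mul_smul_comm,
      mul_smul_comm, ← mul_assoc, ← pow_succ']

/-- The operator `D[1] + ω (id ⊗ τ)`, where `D[1]` acts by left multiplication. -/
def phiOp : Module.End ℂ (Ext n ⊗[ℂ] R) :=
  LinearMap.mulLeft ℂ (Γ.pairSum (negatives n) (positives n) 1) + Γ.omegaTau

/-- The Pfaffian-type generating element `½ ∑ e a e b ⊗ G a b 1` of the whole matrix. -/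
def total : Ext n ⊗[ℂ] R := (2 : ℂ)⁻¹ • Γ.pairSum univ univ 1

lemma total_eq : Γ.total = Γ.raising 0 + Γ.diagonal 0 + Γ.lowering 0 := by
  have hd : Disjoint (negatives n) (positives n) := Finset.disjoint_left.mpr fun _ h =>
    not_mem_positives_of_mem_negatives h
  have hu : (univ : Finset (Idx n)) = (negatives n).disjUnion (positives n) hd := by
    ext a
    have h0 : a.1 ≠ 0 := (Finset.mem_erase.mp a.2).1
    simp only [Finset.mem_univ, Finset.mem_disjUnion, mem_negatives, mem_positives, true_iff]
    omega
  have h : Γ.pairSum univ univ 1 = Γ.pairSum (negatives n) (negatives n) 1 +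
      Γ.pairSum (negatives n) (positives n) 1 + (Γ.pairSum (positives n) (negatives n) 1 +
      Γ.pairSum (positives n) (positives n) 1) := by
    simp only [pairSum]
    rw [hu, Finset.sum_disjUnion]
    simp only [Finset.sum_disjUnion, Finset.sum_add_distrib]
  rw [total, h, Γ.pairSum_swap (positives n) (negatives n), raising, diagonal, lowering, pow_zero,
    one_mul, one_mul, one_mul]
  module

/-- The Gauss decomposition, with the exponentials spelled out. -/
lemma total_pow (N : ℕ) : Γ.total ^ N = (N.factorial : ℂ) •
    PowerSeries.coeff N (expSeries (PowerSeries.X * PowerSeries.mk Γ.raising) *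
      PowerSeries.mk (fun k => (k.factorial : ℂ)⁻¹ • (Γ.phiOp ^ k) 1) *
      expSeries (PowerSeries.X * PowerSeries.mk Γ.lowering)) := by
  rw [total_eq]
  refine Γ.isSlTwoCurrents.gauss (H := fun k => (k.factorial : ℂ)⁻¹ • (Γ.phiOp ^ k) 1)
    (by simp) (fun k => ?_) N
  have h1 : ((k + 1 : ℕ) : ℂ) ≠ 0 := Nat.cast_ne_zero.mpr (by omega)
  have h2 : (k.factorial : ℂ) ≠ 0 := Nat.cast_ne_zero.mpr k.factorial_ne_zero
  have h3 : ((k + 1 : ℕ) : ℂ) * ((k + 1).factorial : ℂ)⁻¹ = (k.factorial : ℂ)⁻¹ := by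
    rw [Nat.factorial_succ]
    push_cast at h1 ⊢
    field_simp
  rw [smul_smul, h3, pow_succ', mul_smul_comm, map_smul, ← smul_add, diagonal, pow_zero, one_mul]
  rfl

end OrthogonalCurrents

end GeneratingElements

/-! ### Expansion of the generating elements into Pfaffians and determinants -/

section Expansion

variable {n : ℕ}

section OrderedProducts

variable {B : Type*} [Ring B]

lemma prod_ofFn_pow_mul {w : B} (hw : ∀ x, Commute w x) : ∀ {l : ℕ} (i : Fin l → ℕ)
    (h : Fin l → B),
    (List.ofFn fun k => w ^ i k * h k).prod = w ^ (∑ k, i k) * (List.ofFn h).prod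
  | 0, _, _ => by simp
  | l + 1, i, h => by
    rw [List.ofFn_succ, List.prod_cons, prod_ofFn_pow_mul hw, List.ofFn_succ, List.prod_cons,
      Fin.sum_univ_succ, pow_add, mul_assoc, mul_assoc, ← mul_assoc (h 0),
      ← ((hw (h 0)).pow_left _).eq, mul_assoc]

variable [Algebra ℂ B]

lemma prod_ofFn_sum {ι : Type*} [DecidableEq ι] {l : ℕ} (S : Finset ι) (h : Fin l → ι → B) :
    (List.ofFn fun k => ∑ y ∈ S, h k y).prod =
      ∑ g ∈ Fintype.piFinset (fun _ => S), (List.ofFn fun k => h k (g k)).prod := by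
  have := (MultilinearMap.mkPiAlgebraFin ℂ l B).map_sum_finset h (fun _ => S)
  simpa only [MultilinearMap.mkPiAlgebraFin_apply] using this

lemma prod_ofFn_smul {l : ℕ} (c : ℂ) (h : Fin l → B) :
    (List.ofFn fun k => c • h k).prod = c ^ l • (List.ofFn h).prod := by
  have := (MultilinearMap.mkPiAlgebraFin ℂ l B).map_smul_univ (fun _ => c) h
  simpa using this

lemma prod_ofFn_tmul {A : Type*} [Ring A] [Algebra ℂ A] : ∀ {l : ℕ} (v : Fin l → A) (c : Fin l → B),
    (List.ofFn fun k => v k ⊗ₜ[ℂ] c k).prod = (List.ofFn v).prod ⊗ₜ (List.ofFn c).prod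
  | 0, _, _ => by simp [Algebra.TensorProduct.one_def]
  | l + 1, v, c => by
    rw [List.ofFn_succ, List.prod_cons, prod_ofFn_tmul, Algebra.TensorProduct.tmul_mul_tmul]
    simp only [List.ofFn_succ, List.prod_cons]

lemma prod_ofFn_map_mulLeft {A : Type*} [Ring A] [Algebra ℂ A] :
    ∀ {l : ℕ} (v : Fin l → A) (c : Fin l → Module.End ℂ B) (x : B),
    (List.ofFn fun k => TensorProduct.map (LinearMap.mulLeft ℂ (v k)) (c k)).prod
      ((1 : A) ⊗ₜ[ℂ] x) = (List.ofFn v).prod ⊗ₜ (List.ofFn c).prod x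
  | 0, _, _, _ => by simp
  | l + 1, v, c, x => by
    rw [List.ofFn_succ, List.prod_cons, Module.End.mul_apply, prod_ofFn_map_mulLeft,
      TensorProduct.map_tmul, LinearMap.mulLeft_apply]
    simp only [List.ofFn_succ, List.prod_cons, Module.End.mul_apply]

end OrderedProducts

/-- Functions on the even and on the odd positions make up a function on all positions. -/
def pairsEquiv (ι : Type*) (l : ℕ) : (Fin l → ι × ι) ≃ (Fin (2 * l) → ι) where
  toFun g q := if q.1 % 2 = 0 then (g ⟨q.1 / 2, by omega⟩).1 else (g ⟨q.1 / 2, by omega⟩).2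
  invFun f k := (f (evenPos k), f (oddPos k))
  left_inv g := by
    funext k
    refine Prod.ext ?_ ?_
    · simp [evenPos]
    · have h : (2 * k.1 + 1) / 2 = k.1 := by omega
      simp [oddPos, h]
  right_inv f := by
    funext q
    rcases Nat.mod_two_eq_zero_or_one q.1 with h | h
    · dsimp only
      rw [if_pos h]
      congr 1
      ext
      simp only [evenPos]
      omega
    · dsimp only
      rw [if_neg (by rw [h]; exact one_ne_zero)]
      congr 1
      ext
      simp only [oddPos]
      omega

lemma prod_ofFn_evenPos_oddPos {B : Type*} [Monoid B] {l : ℕ} (h : Fin (2 * l) → B) :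
    (List.ofFn fun k => h (evenPos k) * h (oddPos k)).prod = (List.ofFn h).prod := by
  rw [List.ofFn_mul', List.prod_flatten, List.map_ofFn]
  congr 2
  funext k
  simp [evenPos, oddPos, List.ofFn_succ]

variable {R : Type*} [Ring R] [Algebra ℂ R]

namespace OrthogonalCurrents

variable (Γ : OrthogonalCurrents n R)

/-- The Pfaffian `1 / (2ˡ l!) ∑_σ sgn σ G (x_σ(1)) (x_σ(2)) α_1 ⋯ G (x_σ(2l-1)) (x_σ(2l)) α_l`. -/
def pf {l : ℕ} (x : Fin (2 * l) → Idx n) (α : Fin l → ℕ) : R :=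
  (1 / (2 ^ l * (l.factorial : ℂ))) • ∑ σ : Equiv.Perm (Fin (2 * l)), (Equiv.Perm.sign σ : ℤ) •
    (List.ofFn fun k : Fin l => Γ.G (x (σ (evenPos k))) (x (σ (oddPos k))) (α k)).prod

lemma prod_pairs_eq_sum {l : ℕ} (S : Finset (Idx n)) (x : Idx n → Idx n) (α : Fin l → ℕ) :
    (List.ofFn fun k => (2 : ℂ)⁻¹ • ∑ a ∈ S, ∑ b ∈ S,
      (extGen (x a) * extGen (x b)) ⊗ₜ[ℂ] Γ.G (x a) (x b) (α k)).prod =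
    (l.factorial : ℂ) • ∑ I : {I : Finset (Idx n) // I ∈ powersetCard (2 * l) S},
      extWord (List.ofFn fun k => x (subsetEnum I k)) ⊗ₜ[ℂ]
        Γ.pf (fun k => x (subsetEnum I k)) α := by
  simp only [← Finset.sum_product']
  rw [prod_ofFn_smul, prod_ofFn_sum]
  have h1 : ∑ g ∈ Fintype.piFinset (fun _ : Fin l => S ×ˢ S), (List.ofFn fun k =>
      (extGen (x (g k).1) * extGen (x (g k).2)) ⊗ₜ[ℂ] Γ.G (x (g k).1) (x (g k).2) (α k)).prod =
      ∑ f ∈ Fintype.piFinset (fun _ : Fin (2 * l) => S),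
        extWord (List.ofFn fun k => x (f k)) ⊗ₜ[ℂ] (List.ofFn fun k =>
          Γ.G (x (f (evenPos k))) (x (f (oddPos k))) (α k)).prod := by
    refine (Finset.sum_equiv (pairsEquiv (Idx n) l).symm (fun f => ?_) fun f _ => ?_).symm
    · simp only [Fintype.mem_piFinset, Finset.mem_product, pairsEquiv, Equiv.coe_fn_symm_mk]
      refine ⟨fun h k => ⟨h _, h _⟩, fun h q => ?_⟩
      rcases Nat.mod_two_eq_zero_or_one q.1 with hq | hq
      · have h2 := (h ⟨q.1 / 2, by omega⟩).1
        rwa [show evenPos ⟨q.1 / 2, by omega⟩ = q from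
          Fin.ext (by simp only [evenPos]; omega)] at h2
      · have h2 := (h ⟨q.1 / 2, by omega⟩).2
        rwa [show oddPos ⟨q.1 / 2, by omega⟩ = q from Fin.ext (by simp only [oddPos]; omega)] at h2
    · rw [prod_ofFn_tmul]
      congr 1
      rw [extWord, List.map_ofFn, ← prod_ofFn_evenPos_oddPos]
      rfl
  rw [h1, sum_extWord_tmul S (x := x) fun f => (List.ofFn fun k =>
          Γ.G (x (f (evenPos k))) (x (f (oddPos k))) (α k)).prod, Finset.smul_sum, Finset.smul_sum]
  refine Finset.sum_congr rfl fun I _ => ?_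
  rw [pf, ← TensorProduct.tmul_smul, ← TensorProduct.tmul_smul, smul_smul]
  congr 2
  have h2 : (l.factorial : ℂ) ≠ 0 := Nat.cast_ne_zero.mpr l.factorial_ne_zero
  rw [inv_pow]
  field_simp

/-- The sum of the Pfaffians over the partitions of `a` with `l` parts. -/
def pfSum (a : ℕ) {l : ℕ} (x : Fin (2 * l) → Idx n) : R :=
  ∑ α : PartitionOfLength a l, α.coeff • Γ.pf x α.part

/-- The powers of a current collect the Pfaffians: a composition of `a` into `l` parts gives the
modes, and since the terms of the current commute, only its partition matters. -/
lemma coeff_pow_eq_sum {X : ℕ → Ext n ⊗[ℂ] R} (hX : ∀ i j, Commute (X i) (X j))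
    (x : Idx n → Idx n) (S : Finset (Idx n))
    (h : ∀ i, X i = omegaT n R ^ i * ((2 : ℂ)⁻¹ • ∑ a ∈ S, ∑ b ∈ S,
      (extGen (x a) * extGen (x b)) ⊗ₜ[ℂ] Γ.G (x a) (x b) (i + 1))) (a l : ℕ) :
    PowerSeries.coeff a ((PowerSeries.X * PowerSeries.mk X) ^ l) =
      (l.factorial : ℂ) • (omegaT n R ^ (a - l) *
        ∑ I : {I : Finset (Idx n) // I ∈ powersetCard (2 * l) S},
          extWord (List.ofFn fun k => x (subsetEnum I k)) ⊗ₜ[ℂ]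
            Γ.pfSum a (fun k => x (subsetEnum I k))) := by
  have h1 : ∀ α : PartitionOfLength a l, (List.ofFn fun k => X (α.part k - 1)).prod =
      omegaT n R ^ (a - l) * ((l.factorial : ℂ) •
        ∑ I : {I : Finset (Idx n) // I ∈ powersetCard (2 * l) S},
        extWord (List.ofFn fun k => x (subsetEnum I k)) ⊗ₜ[ℂ]
          Γ.pf (fun k => x (subsetEnum I k)) α.part) := by
    intro α
    rw [← prod_pairs_eq_sum]
    simp only [h]
    rw [prod_ofFn_pow_mul commute_omegaT]
    congr 1
    · congr 1
      have h2 : ∑ k, (α.part k - 1) + l = a := by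
        conv_rhs => rw [← α.sum_part]
        rw [Finset.sum_congr rfl fun k _ => (Nat.sub_add_cancel (α.part_pos k)).symm,
          Finset.sum_add_distrib]
        simp
      omega
    · congr 2
      funext k
      rw [Nat.sub_add_cancel (α.part_pos k)]
  rw [coeff_X_mul_mk_pow hX]
  simp only [h1, pfSum, TensorProduct.tmul_sum]
  rw [Finset.sum_comm, Finset.mul_sum, Finset.smul_sum]
  refine Finset.sum_congr rfl fun α _ => ?_
  simp only [TensorProduct.tmul_smul, ← Finset.smul_sum, mul_smul_comm]
  rw [smul_comm]

lemma coeff_pow_lowering (a l : ℕ) :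
    PowerSeries.coeff a ((PowerSeries.X * PowerSeries.mk Γ.lowering) ^ l) =
      (l.factorial : ℂ) • (omegaT n R ^ (a - l) *
        ∑ I : {I : Finset (Idx n) // I ∈ powersetCard (2 * l) (negatives n)},
          extWord (List.ofFn fun k => subsetEnum I k) ⊗ₜ[ℂ]
            Γ.pfSum a (fun k => subsetEnum I k)) :=
  Γ.coeff_pow_eq_sum Γ.isSlTwoCurrents.comm_m (fun i => i) (negatives n) (fun _ => rfl) a l

lemma sum_positives {W : Type*} [AddCommMonoid W] (f : Idx n → W) :
    ∑ a ∈ positives n, f a = ∑ a ∈ negatives n, f a.neg :=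
  Finset.sum_bij' (fun b _ => b.neg) (fun b _ => b.neg)
    (fun _ hb => neg_mem_negatives.mpr hb) (fun _ hb => neg_mem_positives.mpr hb)
    (fun b _ => b.neg_neg) (fun b _ => b.neg_neg) fun b _ => by rw [Idx.neg_neg]

lemma coeff_pow_raising (a l : ℕ) :
    PowerSeries.coeff a ((PowerSeries.X * PowerSeries.mk Γ.raising) ^ l) =
      (l.factorial : ℂ) • (omegaT n R ^ (a - l) *
        ∑ I : {I : Finset (Idx n) // I ∈ powersetCard (2 * l) (negatives n)},
          extWord (List.ofFn fun k => (subsetEnum I k).neg) ⊗ₜ[ℂ]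
            Γ.pfSum a (fun k => (subsetEnum I k).neg)) := by
  refine Γ.coeff_pow_eq_sum Γ.isSlTwoCurrents.comm_p Idx.neg (negatives n) (fun i => ?_) a l
  rw [raising, pairSum, sum_positives]
  simp only [sum_positives]

/-- The powers of `ω` collect the subsets of `{-n, …, -1}`; a word over a subset is followed by the
reversed word over the opposite indices. -/
lemma omega_pow (m : ℕ) : omega n ^ m = (m.factorial : ℂ) •
    ∑ J : {J : Finset (Idx n) // J ∈ powersetCard m (negatives n)},
      extWord (List.ofFn (subsetEnum J)) *
        extWord (List.ofFn fun k => (subsetEnum J k).neg).reverse := by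
  have h : omega n ^ m = (List.ofFn fun _ : Fin m => omega n).prod := by
    rw [List.ofFn_const, List.prod_replicate]
  rw [h]
  simp only [omega]
  rw [prod_ofFn_sum]
  simp only [prod_ofFn_extGen_mul_extGen]
  refine sum_piFinset_of_symmetric (negatives n) _ (fun f hf => ?_) fun f σ => ?_
  · rw [extWord_ofFn_eq_zero hf, zero_mul]
  · rw [extWord_ofFn_comp f σ, extWord_reverse_ofFn_comp (fun k => (f k).neg) σ, smul_mul_smul_comm,
      ← Units.val_mul, Int.units_mul_self, Units.val_one, one_smul]

end OrthogonalCurrents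

end Expansion

/-! ### The column determinant of a Manin matrix -/

section Determinant

variable {n : ℕ} {R : Type*} [Ring R] [Algebra ℂ R]

lemma eq_zero_of_eq_neg {W : Type*} [AddCommGroup W] [Module ℂ W] {x : W} (h : x = -x) : x = 0 := by
  have h1 : (2 : ℂ) • x = 0 := by
    rw [two_smul]
    nth_rewrite 2 [h]
    exact add_neg_cancel x
  exact (smul_eq_zero.mp h1).resolve_left two_ne_zero

namespace OrthogonalCurrents

variable (Γ : OrthogonalCurrents n R)

/-- The operator that stands for `Φ_{i,j} = F_{i,j}[-1] + δ_{ij} ad τ`. -/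
def phi (i j : Idx n) : Module.End ℂ R :=
  LinearMap.mulLeft ℂ (Γ.G i j.neg 1) + if i = j then Γ.τ else 0

/-- The column determinant of the operators `phi`. -/
def det {k : ℕ} (i j : Fin k → Idx n) : Module.End ℂ R :=
  ∑ σ : Equiv.Perm (Fin k), (Equiv.Perm.sign σ : ℤ) •
    (List.ofFn fun q : Fin k => Γ.phi (i (σ q)) (j q)).prod

lemma phi_apply (i j : Idx n) (x : R) :
    Γ.phi i j x = Γ.G i j.neg 1 * x + if i = j then Γ.τ x else 0 := by
  rw [phi, LinearMap.add_apply, LinearMap.mulLeft_apply]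
  split_ifs <;> rfl

lemma ne_neg_of_mem_negatives {i l : Idx n} (hi : i ∈ negatives n) (hl : l ∈ negatives n) :
    i.neg ≠ l := by
  rintro rfl
  exact not_mem_positives_of_mem_negatives hi (neg_mem_negatives.mp hl)

/-- The matrix of the `phi i j` with `i, j < 0` is a Manin matrix: this commutator is symmetric in
`i` and `l`. -/
lemma phi_commutator {i j l k : Idx n} (hi : i ∈ negatives n) (hj : j ∈ negatives n)
    (hl : l ∈ negatives n) (hk : k ∈ negatives n) :
    Γ.phi i j * Γ.phi l k - Γ.phi l k * Γ.phi i j =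
      Γ.phi l j * Γ.phi i k - Γ.phi i k * Γ.phi l j := by
  have h : ∀ {i l : Idx n}, i ∈ negatives n → l ∈ negatives n → ∀ x,
      (Γ.phi i j * Γ.phi l k - Γ.phi l k * Γ.phi i j) x =
      (if j = l then Γ.G i k.neg 2 else 0) * x - (if i = k then Γ.G l j.neg 2 else 0) * x -
      (if l = k then Γ.G i j.neg 2 else 0) * x + (if i = j then Γ.G l k.neg 2 else 0) * x := by
    intro i l hi hl x
    have h1 := congrArg (· * x) (Γ.lie i j.neg l k.neg 1 1)
    have h2 : i.neg = k.neg ↔ i = k := by rw [← Idx.eq_neg_iff, Idx.neg_neg]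
    have h3 : j = k.neg ↔ False := iff_false_intro (ne_neg_of_mem_negatives hk hj).symm
    have h4 : i.neg = l ↔ False := iff_false_intro (ne_neg_of_mem_negatives hi hl)
    have h5 := Γ.antisymm j.neg l 2
    simp only [h2, h3, h4, Idx.neg_neg, if_false, sub_zero, sub_mul, mul_assoc, add_mul,
      one_add_one_eq_two, h5] at h1
    have h6 : ∀ y, Γ.τ (Γ.G i j.neg 1 * y) = Γ.G i j.neg 2 * y + Γ.G i j.neg 1 * Γ.τ y := by
      intro y
      rw [Γ.τ_mul, Γ.τ_G, Nat.cast_one, one_smul]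
    have h7 : ∀ y, Γ.τ (Γ.G l k.neg 1 * y) = Γ.G l k.neg 2 * y + Γ.G l k.neg 1 * Γ.τ y := by
      intro y
      rw [Γ.τ_mul, Γ.τ_G, Nat.cast_one, one_smul]
    simp only [LinearMap.sub_apply, Module.End.mul_apply, phi_apply, mul_add]
    rw [sub_eq_iff_eq_add] at h1
    rw [h1]
    split_ifs <;> simp only [map_add, h6, h7, zero_mul, neg_mul, mul_zero, add_zero] <;>
      abel
  refine LinearMap.ext fun x => ?_
  rw [h hi hl, h hl hi]
  simp only [eq_comm (a := j)]
  abel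

/-- The operator `∑ e i ⊗ phi i j`, the sum over `i < 0`. -/
def phiColumn (j : Idx n) : Module.End ℂ (Ext n ⊗[ℂ] R) :=
  ∑ i ∈ negatives n, TensorProduct.map (LinearMap.mulLeft ℂ (extGen i)) (Γ.phi i j)

lemma phiColumn_mul (j k : Idx n) : Γ.phiColumn j * Γ.phiColumn k =
    ∑ i ∈ negatives n, ∑ l ∈ negatives n,
      TensorProduct.map (LinearMap.mulLeft ℂ (extGen i * extGen l)) (Γ.phi i j * Γ.phi l k) := by
  rw [phiColumn, phiColumn, Finset.sum_mul_sum]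
  refine Finset.sum_congr rfl fun i _ => Finset.sum_congr rfl fun l _ => ?_
  rw [← TensorProduct.map_mul, LinearMap.mulLeft_mul]
  rfl

lemma mulLeft_neg_map (w : Ext n) (f : Module.End ℂ R) :
    TensorProduct.map (LinearMap.mulLeft ℂ (-w)) f =
      -TensorProduct.map (LinearMap.mulLeft ℂ w) f := by
  refine TensorProduct.ext' fun v x => ?_
  simp [TensorProduct.neg_tmul]

lemma map_mulLeft_sub (w : Ext n) (f g : Module.End ℂ R) :
    TensorProduct.map (LinearMap.mulLeft ℂ w) (f - g) =
      TensorProduct.map (LinearMap.mulLeft ℂ w) f -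
        TensorProduct.map (LinearMap.mulLeft ℂ w) g := by
  refine TensorProduct.ext' fun v x => ?_
  simp [TensorProduct.tmul_sub]

lemma phiColumn_anticomm {j k : Idx n} (hj : j ∈ negatives n) (hk : k ∈ negatives n) :
    Γ.phiColumn j * Γ.phiColumn k + Γ.phiColumn k * Γ.phiColumn j = 0 := by
  set Y : Idx n → Idx n → Module.End ℂ (Ext n ⊗[ℂ] R) := fun i l =>
    TensorProduct.map (LinearMap.mulLeft ℂ (extGen i * extGen l))
      (Γ.phi i j * Γ.phi l k - Γ.phi l k * Γ.phi i j) with hY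
  have h1 : Γ.phiColumn j * Γ.phiColumn k + Γ.phiColumn k * Γ.phiColumn j =
      ∑ i ∈ negatives n, ∑ l ∈ negatives n, Y i l := by
    rw [phiColumn_mul, phiColumn_mul, Finset.sum_comm (f := fun i l => TensorProduct.map
      (LinearMap.mulLeft ℂ (extGen i * extGen l)) (Γ.phi i k * Γ.phi l j))]
    simp only [← Finset.sum_add_distrib, hY, map_mulLeft_sub]
    refine Finset.sum_congr rfl fun i _ => Finset.sum_congr rfl fun l _ => ?_
    rw [extGen_mul_extGen l i, mulLeft_neg_map, sub_eq_add_neg]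
  have h2 : ∑ i ∈ negatives n, ∑ l ∈ negatives n, Y i l =
      -∑ i ∈ negatives n, ∑ l ∈ negatives n, Y i l := by
    conv_lhs => rw [Finset.sum_comm]
    simp only [← Finset.sum_neg_distrib]
    refine Finset.sum_congr rfl fun i hi => Finset.sum_congr rfl fun l hl => ?_
    simp only [hY]
    rw [Γ.phi_commutator hl hj hi hk, extGen_mul_extGen l i, mulLeft_neg_map]
  rw [h1]
  exact eq_zero_of_eq_neg h2

/-- The algebra map that sends the generator `e j` with `j < 0` to the operator `phiColumn j`. -/
def columnHom : Ext n →ₐ[ℂ] Module.End ℂ (Ext n ⊗[ℂ] R) :=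
  ExteriorAlgebra.lift ℂ ⟨∑ j ∈ negatives n, (LinearMap.proj j).smulRight (Γ.phiColumn j), by
    intro v
    simp only [LinearMap.sum_apply, LinearMap.smulRight_apply, LinearMap.proj_apply]
    set Z := (∑ j ∈ negatives n, v j • Γ.phiColumn j) *
      ∑ j ∈ negatives n, v j • Γ.phiColumn j with hZ
    have h1 : Z = ∑ j ∈ negatives n, ∑ k ∈ negatives n,
        (v j * v k) • (Γ.phiColumn j * Γ.phiColumn k) := by
      rw [hZ, Finset.sum_mul_sum]
      simp only [smul_mul_smul_comm]
    have h2 : Z = -Z := by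
      rw [h1]
      conv_lhs => rw [Finset.sum_comm]
      simp only [← Finset.sum_neg_distrib]
      refine Finset.sum_congr rfl fun j hj => Finset.sum_congr rfl fun k hk => ?_
      rw [mul_comm (v k), eq_neg_of_add_eq_zero_left (Γ.phiColumn_anticomm hk hj)]
      exact smul_neg _ _
    exact eq_zero_of_eq_neg h2⟩

lemma columnHom_extGen {j : Idx n} (hj : j ∈ negatives n) :
    Γ.columnHom (extGen j) = Γ.phiColumn j := by
  rw [columnHom, extGen, ExteriorAlgebra.lift_ι_apply]
  simp only [LinearMap.sum_apply, LinearMap.smulRight_apply, LinearMap.proj_apply]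
  rw [Finset.sum_eq_single j]
  · rw [Pi.single_eq_same, one_smul]
  · intro k _ hk
    rw [Pi.single_eq_of_ne hk, zero_smul]
  · exact fun h => absurd hj h

/-- A product of columns is a sum over words in the `e i` with `i < 0`; the words with the same
letters, which agree up to sign, add up to a column determinant. -/
lemma columnHom_extWord {k : ℕ} {g : Fin k → Idx n} (hg : ∀ q, g q ∈ negatives n) :
    Γ.columnHom (extWord (List.ofFn g)) 1 =
      ∑ J : {J : Finset (Idx n) // J ∈ powersetCard k (negatives n)},
        extWord (List.ofFn fun q => subsetEnum J q) ⊗ₜ[ℂ] Γ.det (subsetEnum J) g 1 := by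
  have h1 : Γ.columnHom (extWord (List.ofFn g)) =
      (List.ofFn fun q => Γ.phiColumn (g q)).prod := by
    rw [extWord, map_list_prod, List.map_ofFn, List.map_ofFn]
    congr 2
    funext q
    exact Γ.columnHom_extGen (hg q)
  rw [h1]
  simp only [phiColumn]
  rw [prod_ofFn_sum, LinearMap.sum_apply, Algebra.TensorProduct.one_def]
  simp only [prod_ofFn_map_mulLeft]
  have h2 := sum_extWord_tmul (negatives n) (x := fun i : Idx n => i)
    fun f : Fin k → Idx n => (List.ofFn fun q => Γ.phi (f q) (g q)).prod 1
  simp only [extWord, List.map_ofFn] at h2 ⊢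
  refine h2.trans (Finset.sum_congr rfl fun J _ => ?_)
  rw [det, LinearMap.sum_apply]
  rfl

lemma phiOp_eq_sum : Γ.phiOp = ∑ p ∈ negatives n ×ˢ negatives n,
    TensorProduct.map (LinearMap.mulLeft ℂ (extGen p.1 * extGen p.2.neg)) (Γ.phi p.1 p.2) := by
  refine TensorProduct.ext' fun v x => ?_
  rw [Finset.sum_product, phiOp, pairSum, LinearMap.add_apply, LinearMap.mulLeft_apply,
    omegaTau_apply, tauT_tmul, omegaT, Algebra.TensorProduct.tmul_mul_tmul, one_mul, omega]
  simp only [sum_positives, LinearMap.sum_apply, TensorProduct.map_tmul, LinearMap.mulLeft_apply,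
    phi_apply, TensorProduct.tmul_add, Finset.sum_add_distrib, Finset.sum_mul,
    Algebra.TensorProduct.tmul_mul_tmul, TensorProduct.sum_tmul]
  congr 1
  refine Finset.sum_congr rfl fun i hi => ?_
  rw [Finset.sum_eq_single i]
  · rw [if_pos rfl]
  · intro j _ hj
    rw [if_neg hj.symm, TensorProduct.tmul_zero]
  · exact fun h => absurd hi h

/-- The powers of `phiOp`, applied to `1`, collect the column determinants. -/
lemma phiOp_pow_one (k : ℕ) : (Γ.phiOp ^ k) 1 = (k.factorial : ℂ) •
    ∑ J₁ : {J : Finset (Idx n) // J ∈ powersetCard k (negatives n)},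
      ∑ J₂ : {J : Finset (Idx n) // J ∈ powersetCard k (negatives n)},
        (extWord (List.ofFn (subsetEnum J₂)) *
          extWord (List.ofFn fun q => (subsetEnum J₁ q).neg).reverse) ⊗ₜ[ℂ]
            Γ.det (subsetEnum J₂) (subsetEnum J₁) 1 := by
  have h1 : Γ.phiOp ^ k = (List.ofFn fun _ : Fin k => Γ.phiOp).prod := by
    rw [List.ofFn_const, List.prod_replicate]
  set V : (Fin k → Idx n) → Ext n ⊗[ℂ] R := fun g =>
    Γ.columnHom (extWord (List.ofFn g)) 1 *
      (extWord (List.ofFn fun q => (g q).neg).reverse ⊗ₜ[ℂ] (1 : R)) with hV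
  have h2 : (Γ.phiOp ^ k) 1 = ∑ g ∈ Fintype.piFinset (fun _ : Fin k => negatives n), V g := by
    rw [h1, phiOp_eq_sum, prod_ofFn_sum, LinearMap.sum_apply, Algebra.TensorProduct.one_def]
    simp only [prod_ofFn_map_mulLeft, prod_ofFn_extGen_mul_extGen]
    have h3 : ∀ g ∈ Fintype.piFinset (fun _ : Fin k => negatives n), V g =
        ∑ f ∈ Fintype.piFinset (fun _ : Fin k => negatives n),
          (extWord (List.ofFn f) * extWord (List.ofFn fun q => (g q).neg).reverse) ⊗ₜ[ℂ]
            (List.ofFn fun q => Γ.phi (f q) (g q)).prod 1 := by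
      intro g hg
      simp only [hV]
      rw [Γ.columnHom_extWord (Fintype.mem_piFinset.mp hg)]
      have h4 := sum_extWord_tmul (negatives n) (x := fun i : Idx n => i)
        fun f : Fin k → Idx n => (List.ofFn fun q => Γ.phi (f q) (g q)).prod 1
      have h5 : ∀ J : {J : Finset (Idx n) // J ∈ powersetCard k (negatives n)},
          Γ.det (subsetEnum J) g 1 = ∑ σ : Equiv.Perm (Fin k), (Equiv.Perm.sign σ : ℤ) •
            (List.ofFn fun q => Γ.phi (subsetEnum J (σ q)) (g q)).prod 1 := by
        intro J
        rw [det, LinearMap.sum_apply]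
        rfl
      simp only [h5]
      rw [← h4, Finset.sum_mul]
      simp only [Algebra.TensorProduct.tmul_mul_tmul, mul_one]
    rw [Finset.sum_congr rfl h3, ← Finset.sum_product']
    refine Finset.sum_nbij' (fun p => (fun q => (p q).2, fun q => (p q).1))
      (fun p q => (p.2 q, p.1 q)) ?_ ?_ ?_ ?_ ?_
    · intro p hp
      simp only [Fintype.mem_piFinset, Finset.mem_product] at hp ⊢
      exact ⟨fun q => (hp q).2, fun q => (hp q).1⟩
    · intro p hp
      simp only [Fintype.mem_piFinset, Finset.mem_product] at hp ⊢
      exact fun q => ⟨hp.2 q, hp.1 q⟩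
    · exact fun _ _ => rfl
    · exact fun _ _ => rfl
    · exact fun _ _ => rfl
  rw [h2, sum_piFinset_of_symmetric (negatives n) V]
  · congr 1
    refine Finset.sum_congr rfl fun J₁ _ => ?_
    simp only [hV]
    rw [Γ.columnHom_extWord fun q => (mem_powersetCard.mp J₁.2).1 (subsetEnum_mem J₁ q),
      Finset.sum_mul]
    simp only [Algebra.TensorProduct.tmul_mul_tmul, mul_one]
  · intro f hf
    simp only [hV]
    rw [extWord_ofFn_eq_zero hf, map_zero, LinearMap.zero_apply, zero_mul]
  · intro f σ
    simp only [hV]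
    rw [extWord_ofFn_comp f σ, extWord_reverse_ofFn_comp (fun q => (f q).neg) σ, map_zsmul,
      LinearMap.smul_apply, ← TensorProduct.smul_tmul', smul_mul_smul_comm, ← Units.val_mul,
      Int.units_mul_self, Units.val_one, one_smul]

end OrthogonalCurrents

end Determinant

/-! ### The coefficient of the top word -/

section TopCoefficient

variable {n : ℕ}

lemma ofFn_subsetEnum {m : ℕ} {S : Finset (Idx n)}
    (I : {I : Finset (Idx n) // I ∈ powersetCard m S}) :
    List.ofFn (subsetEnum I) = increasing I.1 :=
  ofFn_orderEmbOfFin _ _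

lemma ofFn_neg_subsetEnum {m : ℕ} {S : Finset (Idx n)}
    (I : {I : Finset (Idx n) // I ∈ powersetCard m S}) :
    (List.ofFn fun k => (subsetEnum I k).neg) = negString I.1 := by
  rw [negString, ← ofFn_subsetEnum, List.map_ofFn]
  rfl

lemma length_increasing (I : Finset (Idx n)) : (increasing I).length = #I :=
  Finset.length_sort _

lemma length_negString (I : Finset (Idx n)) : (negString I).length = #I := by
  rw [negString, List.length_map, length_increasing]

lemma length_negStringRev (I : Finset (Idx n)) : (negStringRev I).length = #I := by
  rw [negStringRev, List.length_reverse, length_negString]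

lemma mem_increasing {I : Finset (Idx n)} {i : Idx n} : i ∈ increasing I ↔ i ∈ I :=
  Finset.mem_sort _

lemma mem_negString {I : Finset (Idx n)} {i : Idx n} : i ∈ negString I ↔ i.neg ∈ I := by
  rw [negString, List.mem_map]
  simp only [mem_increasing]
  exact ⟨fun ⟨j, hj, h⟩ => by rwa [← h, Idx.neg_neg], fun h => ⟨_, h, i.neg_neg⟩⟩

lemma mem_negStringRev {I : Finset (Idx n)} {i : Idx n} : i ∈ negStringRev I ↔ i.neg ∈ I := by
  rw [negStringRev, List.mem_reverse, mem_negString]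

lemma nodup_increasing (I : Finset (Idx n)) : (increasing I).Nodup :=
  Finset.sort_nodup _ _

lemma nodup_negString (I : Finset (Idx n)) : (negString I).Nodup :=
  (nodup_increasing I).map fun i j h => by rw [← i.neg_neg, h, Idx.neg_neg]

lemma nodup_negStringRev (I : Finset (Idx n)) : (negStringRev I).Nodup :=
  List.nodup_reverse.mpr (nodup_negString I)

lemma card_idx (n : ℕ) : Fintype.card (Idx n) = 2 * n := by
  rw [Fintype.card_coe, Finset.card_erase_of_mem (by simp), Int.card_Icc]
  omega

lemma enum_strictMono (n : ℕ) : StrictMono (Idx.enum n) := by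
  intro i j hij
  have h : (i : ℕ) < j := hij
  rw [← Subtype.coe_lt_coe]
  simp only [Idx.enum]
  split_ifs <;> omega

lemma card_positives (n : ℕ) : #(positives n) = #(negatives n) :=
  Finset.card_bij' (fun b _ => b.neg) (fun b _ => b.neg)
    (fun _ hb => neg_mem_negatives.mpr hb) (fun _ hb => neg_mem_positives.mpr hb)
    (fun b _ => b.neg_neg) (fun b _ => b.neg_neg)

lemma card_negatives (n : ℕ) : #(negatives n) = n := by
  have h1 : (univ : Finset (Idx n)) = negatives n ∪ positives n := by
    ext a
    have h0 : a.1 ≠ 0 := (Finset.mem_erase.mp a.2).1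
    simp only [Finset.mem_univ, Finset.mem_union, mem_negatives, mem_positives, true_iff]
    omega
  have h2 : #(univ : Finset (Idx n)) = #(negatives n) + #(positives n) := by
    rw [h1, Finset.card_union_of_disjoint]
    exact Finset.disjoint_left.mpr fun _ h => not_mem_positives_of_mem_negatives h
  rw [Finset.card_univ, card_idx, card_positives] at h2
  omega

lemma perm_increasing {s : List (Idx n)} {S : Finset (Idx n)} (hs : s.Nodup)
    (hS : ∀ i ∈ s, i ∈ S) (hc : #S ≤ s.length) : s.Perm (increasing S) := by
  have h : s.toFinset = S := by
    refine Finset.eq_of_subset_of_card_le (fun i hi => hS i (List.mem_toFinset.mp hi)) ?_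
    rwa [List.toFinset_card_of_nodup hs]
  rw [List.perm_ext_iff_of_nodup hs (nodup_increasing S)]
  intro i
  rw [mem_increasing, ← h, List.mem_toFinset]

/-- The coefficient of the top word in a word, first over the negative and then over the positive
indices, is the product of the two signs. -/
lemma topFunctional_extWord_mul {ε : Ext n →ₗ[ℂ] ℂ}
    (hε : ε (extWord (increasing (univ : Finset (Idx n)))) = 1) {s t : List (Idx n)}
    (hs : s.Perm (increasing (negatives n))) (ht : t.Perm (increasing (positives n))) :
    ε (extWord s * extWord t) = ((stringSign s * stringSign t : ℤ) : ℂ) := by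
  rw [extWord_eq_stringSign_smul hs (increasing_pairwise _),
    extWord_eq_stringSign_smul ht (increasing_pairwise _), smul_mul_smul_comm, ← extWord_append,
    ← increasing_univ, map_zsmul, hε, zsmul_eq_mul, mul_one]

/-- The shape of the words in the expansion of the Gauss decomposition. -/
def gaussWord (J I₁ J₁ I₂ J₂ : Finset (Idx n)) : Ext n :=
  extWord (increasing J) * extWord (negStringRev J) *
    (extWord (negString I₁) * (extWord (increasing J₂) * extWord (negStringRev J₁)) *
      extWord (increasing I₂))

lemma gaussWord_eq {J I₁ J₁ I₂ J₂ : Finset (Idx n)} (h₁ : Even #I₁) (h₂ : Even #I₂)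
    (hJ : #J₁ = #J₂) : gaussWord J I₁ J₁ I₂ J₂ =
      extWord (increasing J ++ increasing J₂ ++ increasing I₂) *
        extWord (negString I₁ ++ negStringRev J₁ ++ negStringRev J) := by
  have c1 : ∀ x, Commute (extWord (negString I₁)) x :=
    commute_extWord_of_even _ (by rwa [length_negString])
  have c2 : ∀ x, Commute (extWord (increasing I₂)) x :=
    commute_extWord_of_even _ (by rwa [length_increasing])
  have c3 : ∀ x, Commute (extWord (increasing J₂) * extWord (negStringRev J₁)) x := by
    rw [← extWord_append]
    refine commute_extWord_of_even _ ?_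
    rw [List.length_append, length_increasing, length_negStringRev, hJ]
    exact ⟨_, rfl⟩
  simp only [extWord_append]
  set P := extWord (negString I₁)
  set M := extWord (increasing I₂)
  set a := extWord (increasing J)
  set b := extWord (negStringRev J)
  set c := extWord (increasing J₂)
  set d := extWord (negStringRev J₁)
  rw [gaussWord]
  calc a * b * (P * (c * d) * M) = a * (b * (P * (c * d) * M)) := mul_assoc _ _ _
    _ = a * ((P * (c * d) * M) * b) := by
        rw [(((c1 b).mul_left (c3 b)).mul_left (c2 b)).eq]
    _ = a * (c * d * P * M * b) := by rw [(c1 _).eq]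
    _ = a * (c * (d * P * M) * b) := by simp only [mul_assoc]
    _ = a * (c * (M * (P * d)) * b) := by rw [← (c2 (d * P)).eq, ← (c1 d).eq]
    _ = a * c * M * (P * d * b) := by simp only [mul_assoc]

/-- The disjointness that makes both strings of a word free of repetitions. -/
lemma disjoint_of_nodup {J I₁ J₁ I₂ J₂ : Finset (Idx n)}
    (h : (increasing J ++ increasing J₂ ++ increasing I₂ ++
      (negString I₁ ++ negStringRev J₁ ++ negStringRev J)).Nodup) :
    Disjoint I₁ J₁ ∧ Disjoint I₁ J ∧ Disjoint J₁ J ∧ Disjoint J J₂ ∧ Disjoint J I₂ ∧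
      Disjoint J₂ I₂ := by
  simp only [List.nodup_append', List.disjoint_left, List.mem_append, mem_increasing,
    mem_negString, mem_negStringRev] at h
  simp only [Finset.disjoint_left]
  obtain ⟨⟨⟨-, -, a1⟩, -, a2⟩, ⟨⟨-, -, b1⟩, -, b2⟩, -⟩ := h
  refine ⟨fun i hi hi' => ?_, fun i hi hi' => ?_, fun i hi hi' => ?_, fun i hi hi' => a1 hi hi',
    fun i hi hi' => a2 (Or.inl hi) hi', fun i hi hi' => a2 (Or.inr hi) hi'⟩
  · exact b1 (a := i.neg) (by rwa [Idx.neg_neg]) (by rwa [Idx.neg_neg])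
  · exact b2 (a := i.neg) (Or.inl (by rwa [Idx.neg_neg])) (by rwa [Idx.neg_neg])
  · exact b2 (a := i.neg) (Or.inr (by rwa [Idx.neg_neg])) (by rwa [Idx.neg_neg])

lemma card_union_three {S T U : Finset (Idx n)} (h1 : Disjoint S T) (h2 : Disjoint S U)
    (h3 : Disjoint T U) : #(S ∪ T ∪ U) = #S + #T + #U := by
  rw [Finset.card_union_of_disjoint (Finset.disjoint_union_left.mpr ⟨h2, h3⟩),
    Finset.card_union_of_disjoint h1]

/-- A word of the Gauss decomposition vanishes unless its subsets form a pair of partitions of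
`{-n, …, -1}`. -/
lemma exists_subsetData_of_gaussWord_ne_zero {l₁ l₂ k m : ℕ}
    (hm : 2 * m + 2 * k + 2 * l₁ + 2 * l₂ = 2 * n)
    {J I₁ J₁ I₂ J₂ : Finset (Idx n)} (hJ : J ∈ powersetCard m (negatives n))
    (hI₁ : I₁ ∈ powersetCard (2 * l₁) (negatives n)) (hJ₁ : J₁ ∈ powersetCard k (negatives n))
    (hI₂ : I₂ ∈ powersetCard (2 * l₂) (negatives n)) (hJ₂ : J₂ ∈ powersetCard k (negatives n))
    (h : gaussWord J I₁ J₁ I₂ J₂ ≠ 0) :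
    l₁ = l₂ ∧ ∃ S : SubsetData n l₁ k, S.J = J ∧ S.I₁ = I₁ ∧ S.J₁ = J₁ ∧ S.I₂ = I₂ ∧ S.J₂ = J₂ := by
  rw [mem_powersetCard] at hJ hI₁ hJ₁ hI₂ hJ₂
  rw [gaussWord_eq (hI₁.2 ▸ even_two_mul _) (hI₂.2 ▸ even_two_mul _) (hJ₁.2.trans hJ₂.2.symm),
    ← extWord_append] at h
  obtain ⟨d1, d2, d3, d4, d5, d6⟩ := disjoint_of_nodup (not_imp_comm.mp extWord_eq_zero h)
  have c1 := card_union_three d1 d2 d3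
  have c2 := card_union_three d4 d5 d6
  have s1 : I₁ ∪ J₁ ∪ J ⊆ negatives n := Finset.union_subset (Finset.union_subset hI₁.1 hJ₁.1) hJ.1
  have s2 : J ∪ J₂ ∪ I₂ ⊆ negatives n := Finset.union_subset (Finset.union_subset hJ.1 hJ₂.1) hI₂.1
  have e1 := Finset.card_le_card s1
  have e2 := Finset.card_le_card s2
  rw [c1, hI₁.2, hJ₁.2, hJ.2, card_negatives] at e1
  rw [c2, hI₂.2, hJ₂.2, hJ.2, card_negatives] at e2
  have hl : l₁ = l₂ := by omega
  subst hl
  exact ⟨rfl, ⟨J, I₁, J₁, I₂, J₂,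
    Finset.eq_of_subset_of_card_le s1 (by rw [c1, card_negatives]; omega), d1, d2, d3,
    Finset.eq_of_subset_of_card_le s2 (by rw [c2, card_negatives]; omega), d4, d5, d6,
    hI₁.2, hI₂.2, hJ₁.2, hJ₂.2⟩, rfl, rfl, rfl, rfl, rfl⟩

variable {l k : ℕ} (S : SubsetData n l k)

lemma SubsetData.J_subset : S.J ⊆ negatives n := by
  rw [← S.union₁]; exact Finset.subset_union_right

lemma SubsetData.J₁_subset : S.J₁ ⊆ negatives n := by
  rw [← S.union₁]; exact Finset.subset_union_right.trans Finset.subset_union_left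

lemma SubsetData.I₁_subset : S.I₁ ⊆ negatives n := by
  rw [← S.union₁]; exact Finset.subset_union_left.trans Finset.subset_union_left

lemma SubsetData.I₂_subset : S.I₂ ⊆ negatives n := by
  rw [← S.union₂]; exact Finset.subset_union_right

lemma SubsetData.J₂_subset : S.J₂ ⊆ negatives n := by
  rw [← S.union₂]; exact Finset.subset_union_right.trans Finset.subset_union_left

lemma SubsetData.card_J : 2 * l + k + #S.J = n := by
  have h := card_union_three S.disjoint_I₁_J₁ S.disjoint_I₁_J S.disjoint_J₁_J
  rw [S.union₁, card_negatives, S.card_I₁, S.card_J₁] at h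
  exact h.symm

/-- The product of the two signs attached to the subsets. -/
def SubsetData.sign : ℤ :=
  stringSign (increasing S.J ++ increasing S.J₂ ++ increasing S.I₂) *
    stringSign (negString S.I₁ ++ negStringRev S.J₁ ++ negStringRev S.J)

lemma SubsetData.topFunctional_gaussWord {ε : Ext n →ₗ[ℂ] ℂ}
    (hε : ε (extWord (increasing (univ : Finset (Idx n)))) = 1) :
    ε (gaussWord S.J S.I₁ S.J₁ S.I₂ S.J₂) = (S.sign : ℂ) := by
  have hc := S.card_J
  rw [gaussWord_eq (S.card_I₁ ▸ even_two_mul _) (S.card_I₂ ▸ even_two_mul _)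
    (S.card_J₁.trans S.card_J₂.symm), topFunctional_extWord_mul hε, SubsetData.sign]
  · have h1 := Finset.disjoint_left.mp S.disjoint_J_J₂
    have h2 := Finset.disjoint_left.mp S.disjoint_J_I₂
    have h3 := Finset.disjoint_left.mp S.disjoint_J₂_I₂
    refine perm_increasing ?_ ?_ ?_
    · simp only [List.nodup_append', List.disjoint_left, List.mem_append, mem_increasing,
        nodup_increasing, true_and]
      exact ⟨fun i hi => h1 hi, fun i hi => hi.elim (fun h => h2 h) fun h => h3 h⟩
    · simp only [List.mem_append, mem_increasing]
      rintro i ((h | h) | h)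
      exacts [S.J_subset h, S.J₂_subset h, S.I₂_subset h]
    · simp only [List.length_append, length_increasing, card_negatives, S.card_J₂, S.card_I₂]
      omega
  · have h1 := Finset.disjoint_left.mp S.disjoint_I₁_J₁
    have h2 := Finset.disjoint_left.mp S.disjoint_I₁_J
    have h3 := Finset.disjoint_left.mp S.disjoint_J₁_J
    refine perm_increasing ?_ ?_ ?_
    · simp only [List.nodup_append', List.disjoint_left, List.mem_append, mem_negString,
        mem_negStringRev, nodup_negString, nodup_negStringRev, true_and]
      exact ⟨fun i hi => h1 hi, fun i hi => hi.elim (fun h => h2 h) fun h => h3 h⟩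
    · simp only [List.mem_append, mem_negString, mem_negStringRev, ← neg_mem_negatives]
      rintro i ((h | h) | h)
      exacts [S.I₁_subset h, S.J₁_subset h, S.J_subset h]
    · simp only [List.length_append, length_negString, length_negStringRev, card_positives,
        card_negatives, S.card_J₁, S.card_I₁]
      omega

end TopCoefficient

/-! ### The expansion of the Pfaffian of the whole matrix -/

section PfaffianExpansion

variable {n : ℕ} {R : Type*} [Ring R] [Algebra ℂ R]

variable (R) in
/-- The extension `ε ⊗ id` of a functional on the exterior algebra to the tensor product. -/
def tensorFunctional (ε : Ext n →ₗ[ℂ] ℂ) : Ext n ⊗[ℂ] R →ₗ[ℂ] R :=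
  (TensorProduct.lid ℂ R).toLinearMap ∘ₗ ε.rTensor R

lemma tensorFunctional_tmul (ε : Ext n →ₗ[ℂ] ℂ) (w : Ext n) (x : R) :
    tensorFunctional R ε (w ⊗ₜ x) = ε w • x := by
  rw [tensorFunctional, LinearMap.comp_apply, LinearMap.rTensor_tmul]
  exact TensorProduct.lid_tmul _ _

lemma coeff_mul_mul {B : Type*} [Ring B] (U H L : PowerSeries B) (n : ℕ) :
    PowerSeries.coeff n (U * H * L) =
      ∑ ab ∈ (range (n + 1) ×ˢ range (n + 1)).filter (fun ab => ab.1 + ab.2 ≤ n),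
        PowerSeries.coeff ab.1 U * PowerSeries.coeff (n - ab.1 - ab.2) H *
          PowerSeries.coeff ab.2 L := by
  rw [PowerSeries.coeff_mul]
  simp only [PowerSeries.coeff_mul, Finset.sum_mul]
  rw [Finset.sum_sigma']
  refine Finset.sum_bij' (fun x _ => (x.2.1, x.1.2))
    (fun ab _ => ⟨(n - ab.2, ab.2), (ab.1, n - ab.1 - ab.2)⟩) ?_ ?_ ?_ ?_ ?_
  · rintro ⟨⟨p, b⟩, ⟨a, k⟩⟩ h
    simp only [Finset.mem_sigma, Finset.HasAntidiagonal.mem_antidiagonal] at h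
    simp only [Finset.mem_filter, Finset.mem_product, Finset.mem_range]
    omega
  · rintro ⟨a, b⟩ h
    simp only [Finset.mem_filter, Finset.mem_product, Finset.mem_range] at h
    simp only [Finset.mem_sigma, Finset.HasAntidiagonal.mem_antidiagonal]
    omega
  · rintro ⟨⟨p, b⟩, ⟨a, k⟩⟩ h
    simp only [Finset.mem_sigma, Finset.HasAntidiagonal.mem_antidiagonal] at h
    obtain ⟨h1, h2⟩ := h
    subst h2
    have h3 : n - b = a + k := by omega
    have h4 : n - a - b = k := by omega
    simp only [h3, h4]
  · exact fun _ _ => rfl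
  · rintro ⟨⟨p, b⟩, ⟨a, k⟩⟩ h
    simp only [Finset.mem_sigma, Finset.HasAntidiagonal.mem_antidiagonal] at h
    have h4 : n - a - b = k := by omega
    simp only [h4]

lemma sum_reorder {A B C D E W : Type*} [Fintype A] [Fintype B] [Fintype C] [Fintype D]
    [Fintype E] [AddCommMonoid W] (F : A → B → C → D → E → W) :
    ∑ e, ∑ c, ∑ d, ∑ b, ∑ a, F a b c d e = ∑ a, ∑ b, ∑ c, ∑ d, ∑ e, F a b c d e := by
  have h := Fintype.sum_equiv
    (⟨fun t => (t.2.2.2.2, t.2.2.2.1, t.2.1, t.2.2.1, t.1),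
      fun t => (t.2.2.2.2, t.2.2.1, t.2.2.2.1, t.2.1, t.1), fun _ => rfl, fun _ => rfl⟩ :
      E × C × D × B × A ≃ A × B × C × D × E)
    (fun t => F t.2.2.2.2 t.2.2.2.1 t.2.1 t.2.2.1 t.1)
    (fun t => F t.1 t.2.1 t.2.2.1 t.2.2.2.1 t.2.2.2.2) fun _ => rfl
  simpa only [Fintype.sum_prod_type] using h

namespace OrthogonalCurrents

variable (Γ : OrthogonalCurrents n R)

lemma pfSum_eq_zero {a l : ℕ} (h : a < l) (x : Fin (2 * l) → Idx n) : Γ.pfSum a x = 0 :=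
  Finset.sum_eq_zero fun α _ => absurd α.length_le h.not_ge

/-- The sum of the words in the `e (-i)`, with coefficients the Pfaffians of the `F_{-i,j}`. -/
def raisingSum (a l : ℕ) : Ext n ⊗[ℂ] R :=
  ∑ I : {I : Finset (Idx n) // I ∈ powersetCard (2 * l) (negatives n)},
    extWord (negString I.1) ⊗ₜ[ℂ] Γ.pfSum a (fun k => (subsetEnum I k).neg)

/-- The sum of the words in the `e i` and the `e (-i)`, with coefficients the determinants of the
`Φ_{i,j}`. -/
def diagonalSum (k : ℕ) : Ext n ⊗[ℂ] R :=
  ∑ J₁ : {J : Finset (Idx n) // J ∈ powersetCard k (negatives n)},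
    ∑ J₂ : {J : Finset (Idx n) // J ∈ powersetCard k (negatives n)},
      (extWord (increasing J₂.1) * extWord (negStringRev J₁.1)) ⊗ₜ[ℂ]
        Γ.det (subsetEnum J₂) (subsetEnum J₁) 1

/-- The sum of the words in the `e i`, with coefficients the Pfaffians of the `F_{i,-j}`. -/
def loweringSum (a l : ℕ) : Ext n ⊗[ℂ] R :=
  ∑ I : {I : Finset (Idx n) // I ∈ powersetCard (2 * l) (negatives n)},
    extWord (increasing I.1) ⊗ₜ[ℂ] Γ.pfSum a (fun k => subsetEnum I k)

/-- The factor `l!` of `coeff_pow_raising` cancels against the exponential series. -/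
lemma coeff_exp_raising {a N : ℕ} (h : a < N) :
    PowerSeries.coeff a (expSeries (PowerSeries.X * PowerSeries.mk Γ.raising)) =
      ∑ l ∈ range N, omegaT n R ^ (a - l) * Γ.raisingSum a l := by
  rw [coeff_expSeries _ h, map_sum]
  refine Finset.sum_congr rfl fun l _ => ?_
  rw [coeff_complex_smul, coeff_pow_raising, smul_smul,
    inv_mul_cancel₀ (Nat.cast_ne_zero.mpr l.factorial_ne_zero), one_smul]
  simp only [ofFn_neg_subsetEnum]
  rfl

lemma coeff_exp_lowering {a N : ℕ} (h : a < N) :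
    PowerSeries.coeff a (expSeries (PowerSeries.X * PowerSeries.mk Γ.lowering)) =
      ∑ l ∈ range N, omegaT n R ^ (a - l) * Γ.loweringSum a l := by
  rw [coeff_expSeries _ h, map_sum]
  refine Finset.sum_congr rfl fun l _ => ?_
  rw [coeff_complex_smul, coeff_pow_lowering, smul_smul,
    inv_mul_cancel₀ (Nat.cast_ne_zero.mpr l.factorial_ne_zero), one_smul]
  simp only [ofFn_subsetEnum]
  rfl

lemma inv_factorial_smul_phiOp_pow (k : ℕ) :
    (k.factorial : ℂ)⁻¹ • (Γ.phiOp ^ k) 1 = Γ.diagonalSum k := by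
  rw [phiOp_pow_one, smul_smul, inv_mul_cancel₀ (Nat.cast_ne_zero.mpr k.factorial_ne_zero),
    one_smul]
  simp only [ofFn_neg_subsetEnum, ofFn_subsetEnum]
  rfl

variable (n) in
/-- The choices of the subsets `J, I₁, J₁, J₂, I₂` of `{-n, …, -1}` with given sizes. -/
abbrev SubsetTuple (m l₁ k l₂ : ℕ) : Type :=
  {J : Finset (Idx n) // J ∈ powersetCard m (negatives n)} ×
  {I : Finset (Idx n) // I ∈ powersetCard (2 * l₁) (negatives n)} ×
  {J : Finset (Idx n) // J ∈ powersetCard k (negatives n)} ×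
  {J : Finset (Idx n) // J ∈ powersetCard k (negatives n)} ×
  {I : Finset (Idx n) // I ∈ powersetCard (2 * l₂) (negatives n)}

lemma omegaT_pow_mul_sum (a b k l₁ l₂ m : ℕ) :
    omegaT n R ^ m * (Γ.raisingSum a l₁ * Γ.diagonalSum k * Γ.loweringSum b l₂) =
      ∑ t : SubsetTuple n m l₁ k l₂, (m.factorial : ℂ) •
        gaussWord t.1.1 t.2.1.1 t.2.2.1.1 t.2.2.2.2.1 t.2.2.2.1.1 ⊗ₜ[ℂ]
          (Γ.pfSum a (fun q => (subsetEnum t.2.1 q).neg) *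
            Γ.det (subsetEnum t.2.2.2.1) (subsetEnum t.2.2.1) 1 *
              Γ.pfSum b (fun q => subsetEnum t.2.2.2.2 q)) := by
  have h : omegaT n R ^ m = (m.factorial : ℂ) •
      ∑ J : {J : Finset (Idx n) // J ∈ powersetCard m (negatives n)},
        (extWord (increasing J.1) * extWord (negStringRev J.1)) ⊗ₜ[ℂ] (1 : R) := by
    rw [omegaT, Algebra.TensorProduct.tmul_pow, one_pow, omega_pow, ← TensorProduct.smul_tmul',
      TensorProduct.sum_tmul]
    simp only [ofFn_neg_subsetEnum, ofFn_subsetEnum]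
    rfl
  rw [h, raisingSum, diagonalSum, loweringSum]
  simp only [Fintype.sum_prod_type, Finset.smul_sum, Finset.sum_mul, Finset.mul_sum,
    smul_mul_assoc, Algebra.TensorProduct.tmul_mul_tmul, one_mul]
  set F : {J : Finset (Idx n) // J ∈ powersetCard m (negatives n)} →
      {I : Finset (Idx n) // I ∈ powersetCard (2 * l₁) (negatives n)} →
      {J : Finset (Idx n) // J ∈ powersetCard k (negatives n)} →
      {J : Finset (Idx n) // J ∈ powersetCard k (negatives n)} →
      {I : Finset (Idx n) // I ∈ powersetCard (2 * l₂) (negatives n)} → Ext n ⊗[ℂ] R :=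
    fun J I₁ J₁ J₂ I₂ => (m.factorial : ℂ) • gaussWord J.1 I₁.1 J₁.1 I₂.1 J₂.1 ⊗ₜ[ℂ]
      (Γ.pfSum a (fun q => (subsetEnum I₁ q).neg) * Γ.det (subsetEnum J₂) (subsetEnum J₁) 1 *
        Γ.pfSum b (fun q => subsetEnum I₂ q)) with hF
  have h1 := sum_reorder F
  simp only [hF, gaussWord] at h1 ⊢
  exact h1

/-- The contribution of the subsets `S` to the expansion. -/
def term {l k : ℕ} (a b : ℕ) (S : SubsetData n l k) : R :=
  S.sign • (Γ.pfSum a (fun q => (S.I₁.orderEmbOfFin S.card_I₁ q).neg) *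
    (((a + b - 2 * l).factorial : ℂ) •
      Γ.det (S.J₂.orderEmbOfFin S.card_J₂) (S.J₁.orderEmbOfFin S.card_J₁) 1) *
    Γ.pfSum b (S.I₂.orderEmbOfFin S.card_I₂))

/-- At the top word, the Pfaffians on both sides of the determinant have the same size. -/
lemma tensorFunctional_gauss_of_ne {ε : Ext n →ₗ[ℂ] ℂ} {a b k l₁ l₂ : ℕ} (hn : a + b + k = n)
    (hl : l₁ ≠ l₂) :
    tensorFunctional R ε (omegaT n R ^ (a - l₁ + (b - l₂)) *
      (Γ.raisingSum a l₁ * Γ.diagonalSum k * Γ.loweringSum b l₂)) = 0 := by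
  rw [omegaT_pow_mul_sum, map_sum]
  refine Finset.sum_eq_zero fun t _ => ?_
  obtain ⟨J, I₁, J₁, J₂, I₂⟩ := t
  rcases lt_or_ge a l₁ with h | h1
  · simp only [Γ.pfSum_eq_zero h, zero_mul, TensorProduct.tmul_zero, smul_zero, map_zero]
  rcases lt_or_ge b l₂ with h | h2
  · simp only [Γ.pfSum_eq_zero h, mul_zero, TensorProduct.tmul_zero, smul_zero, map_zero]
  have h3 : gaussWord J.1 I₁.1 J₁.1 I₂.1 J₂.1 = 0 := by
    by_contra h
    exact hl (exists_subsetData_of_gaussWord_ne_zero (by omega) J.2 I₁.2 J₁.2 I₂.2 J₂.2 h).1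
  simp only [h3, TensorProduct.zero_tmul, smul_zero, map_zero]

lemma tensorFunctional_gauss_self {ε : Ext n →ₗ[ℂ] ℂ}
    (hε : ε (extWord (increasing (univ : Finset (Idx n)))) = 1) {a b k : ℕ} (hn : a + b + k = n)
    (l : ℕ) :
    tensorFunctional R ε (omegaT n R ^ (a - l + (b - l)) *
      (Γ.raisingSum a l * Γ.diagonalSum k * Γ.loweringSum b l)) =
      ∑ S : SubsetData n l k, Γ.term a b S := by
  rw [omegaT_pow_mul_sum, map_sum]
  -- If `a < l` or `b < l`, there is no partition with `l` parts, and both sides vanish.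
  rcases lt_or_ge a l with h | h1
  · simp only [term, Γ.pfSum_eq_zero h, zero_mul, TensorProduct.tmul_zero, smul_zero, map_zero,
      Finset.sum_const_zero]
  rcases lt_or_ge b l with h | h2
  · simp only [term, Γ.pfSum_eq_zero h, mul_zero, TensorProduct.tmul_zero, smul_zero, map_zero,
      Finset.sum_const_zero]
  have hm : a - l + (b - l) = a + b - 2 * l := by omega
  have hJ : ∀ S : SubsetData n l k, #S.J = a - l + (b - l) := fun S => by
    have := S.card_J
    omega
  refine (Fintype.sum_of_injective (fun S : SubsetData n l k =>
    ((⟨S.J, mem_powersetCard.mpr ⟨S.J_subset, hJ S⟩⟩,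
      ⟨S.I₁, mem_powersetCard.mpr ⟨S.I₁_subset, S.card_I₁⟩⟩,
      ⟨S.J₁, mem_powersetCard.mpr ⟨S.J₁_subset, S.card_J₁⟩⟩,
      ⟨S.J₂, mem_powersetCard.mpr ⟨S.J₂_subset, S.card_J₂⟩⟩,
      ⟨S.I₂, mem_powersetCard.mpr ⟨S.I₂_subset, S.card_I₂⟩⟩) :
      SubsetTuple n (a - l + (b - l)) l k l)) ?_ _ _ ?_ ?_).symm
  · intro S T h
    simp only [Prod.mk.injEq, Subtype.mk.injEq] at h
    cases S
    cases T
    simp_all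
  · rintro ⟨J, I₁, J₁, J₂, I₂⟩ h
    have h3 : gaussWord J.1 I₁.1 J₁.1 I₂.1 J₂.1 = 0 := by
      by_contra h'
      obtain ⟨-, S, e1, e2, e3, e4, e5⟩ :=
        exists_subsetData_of_gaussWord_ne_zero (by omega) J.2 I₁.2 J₁.2 I₂.2 J₂.2 h'
      exact h ⟨S, Prod.ext (Subtype.ext e1) (Prod.ext (Subtype.ext e2)
        (Prod.ext (Subtype.ext e3) (Prod.ext (Subtype.ext e5) (Subtype.ext e4))))⟩
    simp only [h3, TensorProduct.zero_tmul, smul_zero, map_zero]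
  · intro S
    dsimp only
    rw [map_smul, tensorFunctional_tmul, S.topFunctional_gaussWord hε, term, hm, mul_smul_comm,
      smul_mul_assoc, smul_comm, Int.cast_smul_eq_zsmul]
    rfl

/-- The expansion of `½ ∑ e a e b ⊗ F_{a,-b}[-1]` to the power `n` at the top word. -/
lemma tensorFunctional_total_pow {ε : Ext n →ₗ[ℂ] ℂ}
    (hε : ε (extWord (increasing (univ : Finset (Idx n)))) = 1) :
    tensorFunctional R ε (Γ.total ^ n) = (n.factorial : ℂ) • ∑ l ∈ range (n / 2 + 1),
      ∑ ab ∈ (range (n + 1) ×ˢ range (n + 1)).filter (fun ab => ab.1 + ab.2 ≤ n),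
        ∑ S : SubsetData n l (n - ab.1 - ab.2), Γ.term ab.1 ab.2 S := by
  rw [total_pow, map_smul, coeff_mul_mul, map_sum, Finset.sum_comm]
  congr 1
  refine Finset.sum_congr rfl fun ab hab => ?_
  simp only [Finset.mem_filter, Finset.mem_product, Finset.mem_range] at hab
  obtain ⟨⟨ha, hb⟩, hab⟩ := hab
  have hn : ab.1 + ab.2 + (n - ab.1 - ab.2) = n := by omega
  rw [Γ.coeff_exp_raising ha, Γ.coeff_exp_lowering hb, PowerSeries.coeff_mk,
    inv_factorial_smul_phiOp_pow, Finset.sum_mul, Finset.sum_mul_sum, map_sum]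
  have h1 : ∀ l₁ ∈ range (n + 1), tensorFunctional R ε (∑ l₂ ∈ range (n + 1),
      omegaT n R ^ (ab.1 - l₁) * Γ.raisingSum ab.1 l₁ * Γ.diagonalSum (n - ab.1 - ab.2) *
        (omegaT n R ^ (ab.2 - l₂) * Γ.loweringSum ab.2 l₂)) =
      ∑ S : SubsetData n l₁ (n - ab.1 - ab.2), Γ.term ab.1 ab.2 S := by
    intro l₁ hl₁
    simp only [mul_assoc (omegaT n R ^ _) (Γ.raisingSum _ _), omegaT_pow_mul_mul]
    rw [map_sum, Finset.sum_eq_single_of_mem l₁ hl₁ fun l₂ _ h =>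
      Γ.tensorFunctional_gauss_of_ne hn h.symm]
    exact Γ.tensorFunctional_gauss_self hε hn l₁
  rw [Finset.sum_congr rfl h1]
  -- The subsets of size `2 l` of a set with `n` elements force `l ≤ n / 2`.
  refine (Finset.sum_subset (Finset.range_subset_range.mpr (by omega)) fun l _ hl => ?_).symm
  rw [Finset.mem_range, not_lt] at hl
  refine Finset.sum_eq_zero fun S _ => ?_
  have := S.card_J
  omega

/-- The same power as a single Pfaffian. -/
lemma tensorFunctional_total_pow_eq_pf {ε : Ext n →ₗ[ℂ] ℂ}
    (hε : ε (extWord (increasing (univ : Finset (Idx n)))) = 1) :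
    tensorFunctional R ε (Γ.total ^ n) =
      (n.factorial : ℂ) • Γ.pf (Idx.enum n) (fun _ : Fin n => 1) := by
  have hu : (univ : Finset (Idx n)) ∈ powersetCard (2 * n) univ :=
    mem_powersetCard.mpr ⟨Finset.subset_univ _, by rw [Finset.card_univ, card_idx]⟩
  have h : (List.ofFn fun _ : Fin n => Γ.total).prod = Γ.total ^ n := by
    rw [List.ofFn_const, List.prod_replicate]
  have h2 := Γ.prod_pairs_eq_sum univ (fun i => i) (fun _ : Fin n => 1)
  have h3 : subsetEnum (⟨univ, hu⟩ : {I : Finset (Idx n) // I ∈ powersetCard (2 * n) univ}) =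
      Idx.enum n :=
    (Finset.orderEmbOfFin_unique _ (fun _ => Finset.mem_univ _) (enum_strictMono n)).symm
  rw [← h]
  refine (congrArg (tensorFunctional R ε) h2).trans ?_
  rw [map_smul, Fintype.sum_eq_single ⟨univ, hu⟩, tensorFunctional_tmul]
  · rw [ofFn_subsetEnum, hε, one_smul, h3]
  · intro I hI
    refine absurd (Subtype.ext ?_) hI
    rw [← Finset.card_eq_iff_eq_univ, card_idx, (mem_powersetCard.mp I.2).2]

/-- The expansion of the Pfaffian of the whole matrix. -/
theorem pf_enum_eq_sum : Γ.pf (Idx.enum n) (fun _ : Fin n => 1) = ∑ l ∈ range (n / 2 + 1),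
    ∑ ab ∈ (range (n + 1) ×ˢ range (n + 1)).filter (fun ab => ab.1 + ab.2 ≤ n),
      ∑ S : SubsetData n l (n - ab.1 - ab.2), Γ.term ab.1 ab.2 S := by
  obtain ⟨ε, hε⟩ := exists_topFunctional n
  have h := (Γ.tensorFunctional_total_pow_eq_pf hε).symm.trans (Γ.tensorFunctional_total_pow hε)
  exact smul_right_injective R
    (Nat.cast_ne_zero.mpr n.factorial_ne_zero : (n.factorial : ℂ) ≠ 0) h

end OrthogonalCurrents

end PfaffianExpansion

/-! ### The currents of the affine algebra -/

section AffineCurrents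

variable {n : ℕ}

lemma single_mul_single_eq_ite (i j k l : Idx n) :
    Matrix.single i j (1 : ℂ) * Matrix.single k l 1 = if j = k then Matrix.single i l 1 else 0 := by
  split_ifs with h
  · rw [h, Matrix.single_mul_single_same, mul_one]
  · exact Matrix.single_mul_single_of_ne _ _ _ _ h _

lemma genF_neg_swap (a b : Idx n) : genF a b.neg = -genF b a.neg := by
  refine Subtype.ext ?_
  change matF a b.neg = -matF b a.neg
  rw [matF, matF, Idx.neg_neg, Idx.neg_neg, neg_sub]

lemma genF_lie (a b c d : Idx n) : ⁅genF a b.neg, genF c d.neg⁆ =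
    (if b.neg = c then genF a d.neg else 0) - (if a.neg = c then genF b d.neg else 0) -
      (if b.neg = d then genF a c.neg else 0) + (if a.neg = d then genF b c.neg else 0) := by
  refine Subtype.ext ?_
  have h : ∀ {p : Prop} [Decidable p] (x : so n), ((if p then x else 0 : so n) :
      Matrix (Idx n) (Idx n) ℂ) = if p then (x : Matrix (Idx n) (Idx n) ℂ) else 0 := by
    intro p _ x
    split_ifs <;> rfl
  have h1 : d.neg = a ↔ a.neg = d := by rw [← Idx.eq_neg_iff, eq_comm]
  have h2 : d.neg = b ↔ b.neg = d := by rw [← Idx.eq_neg_iff, eq_comm]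
  have h3 : c.neg = a ↔ a.neg = c := by rw [← Idx.eq_neg_iff, eq_comm]
  have h4 : c.neg = b ↔ b.neg = c := by rw [← Idx.eq_neg_iff, eq_comm]
  push_cast
  simp only [h]
  change ⁅matF a b.neg, matF c d.neg⁆ =
    (if b.neg = c then matF a d.neg else 0) - (if a.neg = c then matF b d.neg else 0) -
      (if b.neg = d then matF a c.neg else 0) + (if a.neg = d then matF b c.neg else 0)
  simp only [LieRing.of_associative_ring_bracket, matF, Idx.neg_neg, sub_mul, mul_sub,
    single_mul_single_eq_ite, h1, h2, h3, h4]
  split_ifs <;> abel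

/-- The map `X ↦ X[r]` into the enveloping algebra. -/
def modeU (n : ℕ) (r : ℤ) : so n →ₗ[ℂ] UAffine n where
  toFun X := UniversalEnvelopingAlgebra.ι ℂ (mode X r)
  map_add' X Y := by
    rw [← map_add]
    refine congrArg _ (congrArg LieAlgebra.ofTwoCocycle.mk
      (Prod.ext (TensorProduct.tmul_add _ _ _) ?_))
    exact (add_zero _).symm
  map_smul' c X := by
    rw [RingHom.id_apply, ← map_smul]
    refine congrArg _ (congrArg LieAlgebra.ofTwoCocycle.mk
      (Prod.ext (TensorProduct.tmul_smul _ _ _) ?_))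
    exact (smul_zero _).symm

lemma genU_eq_modeU (i j : Idx n) (r : ℤ) : genU i j r = modeU n r (genF i j) := rfl

/-- Negative modes generate no central terms. -/
lemma modeU_lie (X Y : so n) (r s : ℕ) :
    modeU n (-(r : ℤ)) X * modeU n (-(s : ℤ)) Y - modeU n (-(s : ℤ)) Y * modeU n (-(r : ℤ)) X =
      modeU n (-((r + s : ℕ) : ℤ)) ⁅X, Y⁆ := by
  have h := congrArg (UniversalEnvelopingAlgebra.ι ℂ) (affine_bracket X Y (-(r : ℤ)) (-(s : ℤ)))
  have h0 : (if -(r : ℤ) = -(-(s : ℤ)) then ((-(r : ℤ) : ℤ) : ℂ) else 0) = 0 := by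
    split_ifs with h
    · have : r = 0 := by omega
      rw [this]
      simp
    · rfl
  rw [h0, zero_mul, zero_smul, add_zero, LieHom.map_lie, LieRing.of_associative_ring_bracket] at h
  rw [show (-((r + s : ℕ) : ℤ)) = -(r : ℤ) + -(s : ℤ) by push_cast; ring]
  exact h

/-- The elements `F_{a,-b}[-r]` of the enveloping algebra of the affine algebra, with `ad τ`. -/
def affineCurrents (n : ℕ) : OrthogonalCurrents n (UAffine n) where
  G a b r := genU a b.neg (-(r : ℤ))
  τ := adTau n
  antisymm a b r := by
    rw [genU_eq_modeU, genU_eq_modeU, genF_neg_swap, map_neg]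
  lie a b c d r s := by
    simp only [genU_eq_modeU]
    rw [modeU_lie, genF_lie]
    simp only [map_add, map_sub, apply_ite (modeU n _), map_zero]
  τ_mul x y := envDer_mul _ x y
  τ_G a b r := by
    rw [genU, genU, adTau, envDer_ι, tauDer_mode, map_smul]
    congr 1
    · push_cast
      ring
    · congr 2
      push_cast
      ring

lemma pf_affineCurrents_minusPlus {l : ℕ} (i : Fin (2 * l) → Idx n) (α : Fin l → ℕ) :
    (affineCurrents n).pf (fun q => (i q).neg) α = pfMinusPlus i α := by
  simp only [OrthogonalCurrents.pf, affineCurrents, Idx.neg_neg]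
  rfl

lemma pf_affineCurrents_plusMinus {l : ℕ} (i : Fin (2 * l) → Idx n) (β : Fin l → ℕ) :
    (affineCurrents n).pf i β = pfPlusMinus i β := rfl

lemma det_affineCurrents {k : ℕ} (i j : Fin k → Idx n) :
    (affineCurrents n).det i j = detPhi i j := by
  simp only [OrthogonalCurrents.det, OrthogonalCurrents.phi, affineCurrents, Idx.neg_neg]
  rfl

lemma matFtilde_apply (i j : Idx n) (r : ℤ) : matFtilde n r i j = genU i j.neg r := by
  simp [matFtilde, matU, antiDiag, Matrix.mul_apply]

lemma pf_affineCurrents_enum (n : ℕ) :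
    (affineCurrents n).pf (Idx.enum n) (fun _ : Fin n => 1) = pfFtilde n := by
  have hb : Function.Bijective (Idx.enum n) := (Fintype.bijective_iff_injective_and_card _).mpr
    ⟨(enum_strictMono n).injective, by rw [card_idx, Fintype.card_fin]⟩
  rw [OrthogonalCurrents.pf, pfFtilde]
  congr 1
  refine Fintype.sum_equiv (Equiv.ofBijective _ hb).permCongr _ _ fun σ => ?_
  rw [Equiv.Perm.sign_permCongr]
  have h : ∀ k, (Equiv.ofBijective _ hb).permCongr σ (Idx.enum n k) = Idx.enum n (σ k) := by
    intro k
    rw [Equiv.permCongr_apply, show (Equiv.ofBijective _ hb).symm (Idx.enum n k) = k from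
      (Equiv.ofBijective _ hb).symm_apply_apply k]
    rfl
  simp only [h, matFtilde_apply]
  rfl

end AffineCurrents

end AffinePfaffian

end

open AffinePfaffian

theorem theorem2 (n : ℕ) :
    pfFtilde n =
      ∑ l ∈ Finset.range (n / 2 + 1),
        ∑ ab ∈ (Finset.range (n + 1) ×ˢ Finset.range (n + 1)).filter (fun ab => ab.1 + ab.2 ≤ n),
          ∑ S : SubsetData n l (n - ab.1 - ab.2),
            (stringSign (increasing S.J ++ increasing S.J₂ ++ increasing S.I₂) *
              stringSign (negString S.I₁ ++ negStringRev S.J₁ ++ negStringRev S.J)) •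
            ((∑ α : PartitionOfLength ab.1 l,
                α.coeff • pfMinusPlus (S.I₁.orderEmbOfFin S.card_I₁) α.part) *
              (((ab.1 + ab.2 - 2 * l).factorial : ℂ) •
                detPhi (S.J₂.orderEmbOfFin S.card_J₂) (S.J₁.orderEmbOfFin S.card_J₁) 1) *
              (∑ β : PartitionOfLength ab.2 l,
                β.coeff • pfPlusMinus (S.I₂.orderEmbOfFin S.card_I₂) β.part)) := by
  rw [← pf_affineCurrents_enum, OrthogonalCurrents.pf_enum_eq_sum]
  simp only [OrthogonalCurrents.term, OrthogonalCurrents.pfSum, pf_affineCurrents_minusPlus]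
  simp only [pf_affineCurrents_plusMinus, det_affineCurrents, SubsetData.sign]
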